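/- Let $d,m$ be natural numbers, $t_0<T$, and let $a,\sigma_1,\dots,\sigma_m:\mathbb{R}\times\mathbb{R}^d\to\mathbb{R}^d$ be functions (only their values on $[t_0,T]\times\mathbb{R}^d$ matter) such that $a(t,0)$ and $\sigma_r(t,0)$, $r=1,\dots,m$, are bounded for $t\in[t_0,T]$. Let $p_0\ge 1$ and $\varkappa\ge 1$ be real numbers, and assume that there are constants $c_1,c_2\ge 0$ such that for all $t\in[t_0,T]$ and $x,y\in\mathbb{R}^d$ $$(x-y,\,a(t,x)-a(t,y))+\frac{2p_0-1}{2}\sum_{r=1}^m|\sigma_r(t,x)-\sigma_r(t,y)|^2\le c_1|x-y|^2,$$ $$|a(t,x)-a(t,y)|^2\le c_2\,(1+|x|^{2\varkappa-2}+|y|^{2\varkappa-2})\,|x-y|^2 .$$ Let $p$ be a real number with $$1\le p\le \frac{p_0-1}{4(3\varkappa-2)}-\frac12$$ (such $p$ exist exactly when $p_0$ is sufficiently large, namely $p_0\ge 18\varkappa-11$). Then there are constants $\beta\ge 1$ and $K>0$ such that the following holds for every random vector $X_0$ in $\mathbb{R}^d$, on any probability space, with $\mathbb{E}|X_0|^{2q}<\infty$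 for all $q\ge 1$, for every natural number $N\ge 1$, with $h=(T-t_0)/N$ and $t_k=t_0+kh$, and for all i.i.d. $\mathcal N(0,1)$ random variables $\xi_{rk}$, $r=1,\dots,m$, $k=0,\dots,N-1$, that are jointly independent of $X_0$: the balanced scheme $$X_{k+1}=X_k+\frac{a(t_k,X_k)h+\sum_{r=1}^m\sigma_r(t_k,X_k)\xi_{rk}\sqrt h}{1+h|a(t_k,X_k)|+\sqrt h\sum_{r=1}^m|\sigma_r(t_k,X_k)\xi_{rk}|},\qquad k=0,\dots,N-1,$$ started at $X_0$, satisfies $$\mathbb{E}|X_k|^{2p}\le K\,(1+\mathbb{E}|X_0|^{2p\beta})<\infty\qquad\text{for all }k=0,\dots,N.$$ In particular $\beta$ and $K$ do not depend on $h$, $k$ (or $X_0$). -/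

import Mathlib

open MeasureTheory ProbabilityTheory

/-- The deterministic assumptions on the drift `a` and the diffusion coefficients `σ r`,
`r : Fin m`, on the time interval `[t₀, T]`: the one-sided Lipschitz (coercivity) condition with
parameter `p₀`, and the polynomial local Lipschitz condition on the drift with growth
exponent `ϰ`. -/
structure OneSidedLipschitzCoeffs {d m : ℕ}
    (a : ℝ → EuclideanSpace ℝ (Fin d) → EuclideanSpace ℝ (Fin d))
    (σ : Fin m → ℝ → EuclideanSpace ℝ (Fin d) → EuclideanSpace ℝ (Fin d))
    (t₀ T p₀ ϰ : ℝ) : Prop where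
  one_le_p₀ : 1 ≤ p₀
  one_le_ϰ : 1 ≤ ϰ
  one_sided : ∃ c₁ : ℝ, 0 ≤ c₁ ∧ ∀ t ∈ Set.Icc t₀ T, ∀ x y : EuclideanSpace ℝ (Fin d),
    inner ℝ (x - y) (a t x - a t y)
        + (2 * p₀ - 1) / 2 * ∑ r, ‖σ r t x - σ r t y‖ ^ 2 ≤ c₁ * ‖x - y‖ ^ 2
  poly_lipschitz : ∃ c₂ : ℝ, 0 ≤ c₂ ∧ ∀ t ∈ Set.Icc t₀ T, ∀ x y : EuclideanSpace ℝ (Fin d),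
    ‖a t x - a t y‖ ^ 2
      ≤ c₂ * (1 + ‖x‖ ^ (2 * ϰ - 2) + ‖y‖ ^ (2 * ϰ - 2)) * ‖x - y‖ ^ 2

/-- The coefficients at the origin are bounded uniformly in time on `[t₀, T]`. -/
def BoundedAtOrigin {d m : ℕ}
    (a : ℝ → EuclideanSpace ℝ (Fin d) → EuclideanSpace ℝ (Fin d))
    (σ : Fin m → ℝ → EuclideanSpace ℝ (Fin d) → EuclideanSpace ℝ (Fin d))
    (t₀ T : ℝ) : Prop :=
  ∃ M : ℝ, ∀ t ∈ Set.Icc t₀ T, ‖a t 0‖ ≤ M ∧ ∀ r, ‖σ r t 0‖ ≤ M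

/-- The random vector `X₀` has finite moments `E|X₀|^{2p}` for all real `p ≥ 1`. -/
def HasAllMoments {d : ℕ} {Ω : Type*} [MeasurableSpace Ω] (P : Measure Ω)
    (X₀ : Ω → EuclideanSpace ℝ (Fin d)) : Prop :=
  Measurable X₀ ∧ ∀ p : ℝ, 1 ≤ p → Integrable (fun ω => ‖X₀ ω‖ ^ (2 * p)) P

/-- The driving noise of an `N`-step scheme: `ξ k r`, for `k < N` and `r < m`, are i.i.d. standard
Gaussian random variables, jointly independent of the initial value `X₀`. -/
structure IsGaussianNoise {d m N : ℕ} {Ω : Type*} [MeasurableSpace Ω] (P : Measure Ω)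
    (X₀ : Ω → EuclideanSpace ℝ (Fin d)) (ξ : Fin N → Fin m → Ω → ℝ) : Prop where
  measurable : ∀ k r, Measurable (ξ k r)
  law : ∀ k r, P.map (ξ k r) = gaussianReal 0 1
  indep : iIndepFun (fun (i : Fin N × Fin m) => ξ i.1 i.2) P
  indep_init : IndepFun X₀ (fun ω (i : Fin N × Fin m) => ξ i.1 i.2 ω) P

/-- One step of the balanced scheme with step size `h`, from the point `(t, x)`, with the
realization `z` of the `m` Gaussian variables. -/
noncomputable def balancedStep {d m : ℕ}
    (a : ℝ → EuclideanSpace ℝ (Fin d) → EuclideanSpace ℝ (Fin d))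
    (σ : Fin m → ℝ → EuclideanSpace ℝ (Fin d) → EuclideanSpace ℝ (Fin d))
    (h t : ℝ) (x : EuclideanSpace ℝ (Fin d)) (z : Fin m → ℝ) : EuclideanSpace ℝ (Fin d) :=
  x + (1 + h * ‖a t x‖ + √h * ∑ r, ‖z r • σ r t x‖)⁻¹ •
    (h • a t x + ∑ r, (z r * √h) • σ r t x)

/-- The path `x₀ = X_0, X_1, …, X_N` of the balanced scheme with `N` steps of size `h` on the
grid `t_k = t₀ + k h`, started at `x₀`, with noise realization `z`. -/
noncomputable def balancedPath {d m N : ℕ}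
    (a : ℝ → EuclideanSpace ℝ (Fin d) → EuclideanSpace ℝ (Fin d))
    (σ : Fin m → ℝ → EuclideanSpace ℝ (Fin d) → EuclideanSpace ℝ (Fin d))
    (t₀ h : ℝ) (x₀ : EuclideanSpace ℝ (Fin d)) (z : Fin N → Fin m → ℝ) :
    Fin (N + 1) → EuclideanSpace ℝ (Fin d) :=
  Fin.induction (motive := fun _ => EuclideanSpace ℝ (Fin d)) x₀
    (fun k x => balancedStep a σ h (t₀ + (k : ℕ) * h) x (z k))

/-- The balanced scheme on `[t₀, T]` with `N` steps of size `h = (T - t₀) / N`, started at the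
random vector `X₀` and driven by `ξ`; `balancedScheme a σ t₀ T X₀ ξ k` is the random vector
`X_k`, `k = 0, …, N`. -/
noncomputable def balancedScheme {d m N : ℕ} {Ω : Type*}
    (a : ℝ → EuclideanSpace ℝ (Fin d) → EuclideanSpace ℝ (Fin d))
    (σ : Fin m → ℝ → EuclideanSpace ℝ (Fin d) → EuclideanSpace ℝ (Fin d))
    (t₀ T : ℝ) (X₀ : Ω → EuclideanSpace ℝ (Fin d)) (ξ : Fin N → Fin m → Ω → ℝ)
    (k : Fin (N + 1)) (ω : Ω) : EuclideanSpace ℝ (Fin d) :=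
  balancedPath a σ t₀ ((T - t₀) / N) (X₀ ω) (fun j r => ξ j r ω) k

/-! Write `V x = 1 + ‖x‖ ^ 2`, fix an integer `q ≥ 3 * p * ϰ`, and let `u n x` be the expectation of
`V ^ p` after `n` further steps from `x`. The claim `u n ≤ B * (1 + K * h) ^ n * V ^ q` is proved by
induction on `n` (`exists_schemeExpectation_le`). A power higher than `p` on the right makes it
possible to treat separately the points where the coefficients are too large for the step size.

If `h * V ^ ((3 * ϰ - 1) / 2) ≤ 1`, one step multiplies the mean of `V ^ q` by at most `1 + K * h`
(`exists_lintegral_balancedIncr_le`). In the Taylor expansion the first order noise term is odd in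
the Gaussian vector and integrates to zero, coercivity controls drift plus second order noise, and
`exists_small_step_bounds` makes the remaining terms `O(h) * V`. Then the induction hypothesis
applies.

Otherwise no step is analysed. Balancing keeps every increment in the unit ball, so the norm grows
by at most `n ≤ N`, while `N = (T - t₀) / h` is itself below `(T - t₀) * V ^ ((3 * ϰ - 1) / 2)`.
Hence `V ^ p` stays below a constant times `V ^ (3 * p * ϰ)`, hence times `V ^ q`
(`one_add_sq_rpow_le_of_large`). This bound does not use the recursion, so its constant does not
accumulate.

Since `(1 + K * h) ^ n ≤ exp (K * (T - t₀))`, the constants are uniform in `N`. Independence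
identifies `u` with the moments of the scheme, and `β = q / p`. -/

/-! ### Taylor estimates for powers of `1 + ‖x‖ ^ 2`. -/

/-- Second order Taylor bound for a natural power, with a cubic remainder. -/
theorem exists_one_add_pow_le (q : ℕ) : ∃ C : ℝ, 0 ≤ C ∧ ∀ s : ℝ, -1 ≤ s → s ≤ 3 →
    (1 + s) ^ q ≤ 1 + q * s + q * (q - 1) / 2 * s ^ 2 + C * |s| ^ 3 := by
  induction q with
  | zero => exact ⟨0, le_rfl, fun s _ _ => by simp⟩
  | succ n ih =>
    obtain ⟨C, hC, h⟩ := ih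
    -- Multiplying the bound for `n` by `1 + s ∈ [0, 4]` turns the old remainder into at most `4 * C
    -- * |s| ^ 3` and creates one new cubic term.
    refine ⟨n * (n + 1) + 4 * C, by positivity, fun s h1 h3 => ?_⟩
    have key := mul_le_mul_of_nonneg_right (h s h1 h3) (by linarith : (0 : ℝ) ≤ 1 + s)
    have e1 : s ^ 3 ≤ |s| ^ 3 := by rw [← abs_pow]; exact le_abs_self _
    have e0 : (0 : ℝ) ≤ |s| ^ 3 := by positivity
    have e2 : C * |s| ^ 3 * (1 + s) ≤ C * |s| ^ 3 * 4 :=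
      mul_le_mul_of_nonneg_left (by linarith) (by positivity)
    have hn : (0 : ℝ) ≤ n := by positivity
    have e3 : (n : ℝ) * (n - 1) / 2 * s ^ 3 ≤ n * (n + 1) * |s| ^ 3 := by
      have : (0 : ℝ) ≤ n * (n - 1) / 2 := by
        rcases Nat.eq_zero_or_pos n with rfl | hp
        · simp
        · have : (1 : ℝ) ≤ n := by exact_mod_cast hp
          have : (0 : ℝ) ≤ n - 1 := by linarith
          positivity
      calc (n : ℝ) * (n - 1) / 2 * s ^ 3 ≤ n * (n - 1) / 2 * |s| ^ 3 :=
            mul_le_mul_of_nonneg_left e1 this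
        _ ≤ _ := mul_le_mul_of_nonneg_right (by nlinarith) e0
    rw [pow_succ]
    push_cast
    linarith

/-- The increment `u = 2 i + D ^ 2` of `V = 1 + X ^ 2` is small relative to `V`. -/
theorem increment_bounds {X D i : ℝ} (hx : 0 ≤ X) (hd : 0 ≤ D) (hδ : D ≤ 1) (hi : |i| ≤ X * D) :
    2 * i + D ^ 2 ≤ 3 * (1 + X ^ 2) ∧
    (2 * i + D ^ 2) ^ 2 ≤ (4 * D ^ 2 + 5 * D ^ 3) * (1 + X ^ 2) ∧
    |2 * i + D ^ 2| ^ 3 ≤ 27 * D ^ 3 * (1 + X ^ 2) ^ 2 := by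
  have hXV : 2 * X ≤ 1 + X ^ 2 := by nlinarith [sq_nonneg (X - 1)]
  have hXD : X * D ≤ X := mul_le_of_le_one_right hx hδ
  obtain ⟨hi1, hi2⟩ := abs_le.1 hi
  have hDD : D ^ 2 ≤ D := by nlinarith
  have hD3 : 0 ≤ D ^ 3 := by positivity
  have habs : |2 * i + D ^ 2| ≤ (2 * X + 1) * D := by
    rw [abs_le]; constructor <;> nlinarith [sq_nonneg D]
  refine ⟨by linarith [sq_nonneg X], ?_, ?_⟩
  · have h1 : i ^ 2 ≤ (X * D) ^ 2 := sq_le_sq' hi1 hi2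
    have h2 : i * D ^ 2 ≤ X * D * D ^ 2 := mul_le_mul_of_nonneg_right hi2 (by positivity)
    have h3 : D ^ 3 * D ≤ D ^ 3 := mul_le_of_le_one_right hD3 hδ
    have h4 : 2 * X * D ^ 3 ≤ (1 + X ^ 2) * D ^ 3 := mul_le_mul_of_nonneg_right hXV hD3
    have h5 : 0 ≤ X ^ 2 * D ^ 3 := by positivity
    linarith [sq_nonneg D]
  · calc |2 * i + D ^ 2| ^ 3 ≤ ((2 * X + 1) * D) ^ 3 := by gcongr
      _ = (2 * X + 1) ^ 2 * (2 * X + 1) * D ^ 3 := by ring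
      _ ≤ (5 * (1 + X ^ 2)) * (2 * (1 + X ^ 2)) * D ^ 3 := by
        gcongr
        · nlinarith [sq_nonneg (X - 2)]
        · linarith [sq_nonneg X]
      _ = 10 * ((1 + X ^ 2) ^ 2 * D ^ 3) := by ring
      _ ≤ 27 * ((1 + X ^ 2) ^ 2 * D ^ 3) := by gcongr; norm_num
      _ = _ := by ring

/-- Growth of `(1 + ‖x‖ ^ 2) ^ q` along an increment of norm at most one. -/
theorem exists_one_add_norm_sq_pow_le {E : Type*} [NormedAddCommGroup E]
    [InnerProductSpace ℝ E] (q : ℕ) (hq : 1 ≤ q) :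
    ∃ C : ℝ, 0 ≤ C ∧ ∀ x δ : E, ‖δ‖ ≤ 1 →
      (1 + ‖x + δ‖ ^ 2) ^ q ≤ (1 + ‖x‖ ^ 2) ^ (q - 1) *
        (1 + ‖x‖ ^ 2 + 2 * q * inner ℝ x δ + 2 * q * (q - 1 / 2) * ‖δ‖ ^ 2 + C * ‖δ‖ ^ 3) := by
  obtain ⟨C, hC, h⟩ := exists_one_add_pow_le q
  have hq1 : (1 : ℝ) ≤ q := by exact_mod_cast hq
  refine ⟨q * (q - 1) / 2 * 5 + C * 27, ?_, fun x δ hδ => ?_⟩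
  · have : (0 : ℝ) ≤ q - 1 := by linarith
    positivity
  have hexp : 1 + ‖x + δ‖ ^ 2 = 1 + ‖x‖ ^ 2 + (2 * inner ℝ x δ + ‖δ‖ ^ 2) := by
    rw [norm_add_sq_real]; ring
  have hi := abs_real_inner_le_norm x δ
  obtain ⟨hu3, hu2, hu4⟩ := increment_bounds (norm_nonneg x) (norm_nonneg δ) hδ hi
  have hV1 : 1 ≤ 1 + ‖x‖ ^ 2 := by linarith [sq_nonneg ‖x‖]
  have hn := sq_nonneg ‖x + δ‖
  set i : ℝ := inner ℝ x δ
  set D := ‖δ‖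
  generalize hV : 1 + ‖x‖ ^ 2 = V at *
  have hV0 : 0 < V := by linarith
  generalize hu : 2 * i + D ^ 2 = u at *
  -- The relative increment is at least `-1` because `V + u = 1 + ‖x + δ‖ ^ 2` is nonnegative, and
  -- at most `3` because `‖δ‖ ≤ 1`.
  have hs := h (u / V) (by rw [le_div_iff₀ hV0]; linarith) (by rw [div_le_iff₀ hV0]; linarith)
  have hu2' : u ^ 2 / V ≤ 4 * D ^ 2 + 5 * D ^ 3 := by rwa [div_le_iff₀ hV0]
  have hu3' : |u| ^ 3 / V ^ 2 ≤ 27 * D ^ 3 := by rwa [div_le_iff₀ (by positivity)]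
  have hq2 : (0 : ℝ) ≤ q * (q - 1) / 2 := by
    have : (0 : ℝ) ≤ q - 1 := by linarith
    positivity
  calc (1 + ‖x + δ‖ ^ 2) ^ q = (V * (1 + u / V)) ^ q := by
        rw [hexp]; congr 1; field_simp
    _ = V ^ (q - 1) * (V * (1 + u / V) ^ q) := by
        rw [mul_pow, ← mul_assoc, ← pow_succ, Nat.sub_add_cancel hq]
    _ ≤ V ^ (q - 1) * (V * (1 + q * (u / V) + q * (q - 1) / 2 * (u / V) ^ 2
          + C * |u / V| ^ 3)) := by gcongr
    _ = V ^ (q - 1) * (V + q * u + q * (q - 1) / 2 * (u ^ 2 / V) + C * (|u| ^ 3 / V ^ 2)) := by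
        rw [abs_div, abs_of_pos hV0]; congr 1; field_simp
    _ ≤ V ^ (q - 1) * (V + q * u + q * (q - 1) / 2 * (4 * D ^ 2 + 5 * D ^ 3)
          + C * (27 * D ^ 3)) := by gcongr
    _ = _ := by rw [← hu]; ring

/-! ### Symmetry and moments of the Gaussian vector. -/

/-- The law of a standard Gaussian vector in `ℝ ^ m`. -/
noncomputable abbrev stdGaussianPi (m : ℕ) : Measure (Fin m → ℝ) :=
  Measure.pi fun _ => gaussianReal 0 1

instance : (gaussianReal 0 1).IsNegInvariant :=
  ⟨by rw [Measure.neg_def]; simpa using gaussianReal_map_neg (μ := 0) (v := 1)⟩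

theorem memLp_eval_stdGaussianPi {m : ℕ} (r : Fin m) (p : NNReal) :
    MemLp (fun z : Fin m → ℝ => z r) p (stdGaussianPi m) :=
  (memLp_id_gaussianReal p).comp_measurePreserving
    (measurePreserving_eval (fun _ : Fin m => gaussianReal 0 1) r)

theorem integral_mul_stdGaussianPi {m : ℕ} (r s : Fin m) :
    ∫ z, z r * z s ∂stdGaussianPi m = if r = s then 1 else 0 := by
  have hmean : ∀ r : Fin m, ∫ z, z r ∂stdGaussianPi m = 0 := fun r => by
    have := integral_map (μ := stdGaussianPi m) (φ := Function.eval r)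
      (measurable_pi_apply r).aemeasurable (f := fun x : ℝ => x) aestronglyMeasurable_id
    rw [(measurePreserving_eval (fun _ : Fin m => gaussianReal 0 1) r).map_eq] at this
    simpa using this.symm
  split_ifs with h
  · subst h
    have hv : Var[fun z : Fin m → ℝ => z r; stdGaussianPi m] = 1 := by
      have := variance_id_gaussianReal (μ := 0) (v := 1)
      rw [← (measurePreserving_eval (fun _ : Fin m => gaussianReal 0 1) r).map_eq,
        variance_map aemeasurable_id (measurable_pi_apply r).aemeasurable] at this
      simpa using this
    rw [variance_of_integral_eq_zero (measurable_pi_apply r).aemeasurable (hmean r)] at hv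
    simpa [sq] using hv
  · have hind : IndepFun (fun z : Fin m → ℝ => z r) (fun z => z s) (stdGaussianPi m) :=
      (iIndepFun_pi (X := fun _ : Fin m => (id : ℝ → ℝ)) fun _ => aemeasurable_id).indepFun h
    rw [hind.integral_fun_mul_eq_mul_integral (measurable_pi_apply r).aestronglyMeasurable
      (measurable_pi_apply s).aestronglyMeasurable, hmean, zero_mul]

theorem integrable_mul_stdGaussianPi {m : ℕ} (r s : Fin m) :
    Integrable (fun z => z r * z s) (stdGaussianPi m) :=
  MemLp.integrable_mul (p := 2) (q := 2) (memLp_eval_stdGaussianPi r 2)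
    (memLp_eval_stdGaussianPi s 2)

theorem memLp_sum_abs_stdGaussianPi (m : ℕ) (p : NNReal) :
    MemLp (fun z : Fin m → ℝ => ∑ r, |z r|) p (stdGaussianPi m) :=
  memLp_finsetSum _ fun r _ => (memLp_eval_stdGaussianPi r p).abs

theorem integrable_sum_abs_pow_stdGaussianPi (m n : ℕ) :
    Integrable (fun z : Fin m → ℝ => (∑ r, |z r|) ^ n) (stdGaussianPi m) := by
  have := (memLp_sum_abs_stdGaussianPi m n).integrable_norm_pow'
  refine this.congr (Filter.Eventually.of_forall fun z => ?_)
  simp [abs_of_nonneg (Finset.sum_nonneg fun r _ => abs_nonneg (z r))]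

/-! ### One step of the scheme with frozen coefficients. -/

section Increment

variable {E : Type*} [NormedAddCommGroup E] [InnerProductSpace ℝ E] {m : ℕ}

theorem norm_sum_smul_sq_eq (s : Fin m → E) (z : Fin m → ℝ) :
    ‖∑ r, z r • s r‖ ^ 2 = ∑ r, ∑ r', z r * z r' * inner ℝ (s r) (s r') := by
  rw [← real_inner_self_eq_norm_sq, sum_inner]
  refine Finset.sum_congr rfl fun r _ => ?_
  rw [inner_sum]
  refine Finset.sum_congr rfl fun r' _ => ?_
  rw [real_inner_smul_left, real_inner_smul_right]; ring

theorem integrable_norm_sum_smul_sq (s : Fin m → E) :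
    Integrable (fun z => ‖∑ r, z r • s r‖ ^ 2) (stdGaussianPi m) := by
  simp_rw [norm_sum_smul_sq_eq]
  exact integrable_finsetSum _ fun r _ => integrable_finsetSum _ fun r' _ =>
    (integrable_mul_stdGaussianPi r r').mul_const _

theorem integral_norm_sum_smul_sq (s : Fin m → E) :
    ∫ z, ‖∑ r, z r • s r‖ ^ 2 ∂stdGaussianPi m = ∑ r, ‖s r‖ ^ 2 := by
  simp_rw [norm_sum_smul_sq_eq]
  rw [integral_finsetSum _ fun r _ => integrable_finsetSum _ fun r' _ =>
    (integrable_mul_stdGaussianPi r r').mul_const _]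
  refine Finset.sum_congr rfl fun r _ => ?_
  rw [integral_finsetSum _ fun r' _ => (integrable_mul_stdGaussianPi r r').mul_const _]
  simp [integral_mul_const, integral_mul_stdGaussianPi]

/-- The denominator of the balanced scheme. -/
noncomputable def balancedDenom (h : ℝ) (a : E) (s : Fin m → E) (z : Fin m → ℝ) : ℝ :=
  1 + h * ‖a‖ + √h * ∑ r, ‖z r • s r‖

/-- The increment of the balanced scheme. -/
noncomputable def balancedIncr (h : ℝ) (a : E) (s : Fin m → E) (z : Fin m → ℝ) : E :=
  (balancedDenom h a s z)⁻¹ • (h • a + ∑ r, (z r * √h) • s r)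

theorem one_le_balancedDenom {h : ℝ} (hh : 0 ≤ h) (a : E) (s : Fin m → E) (z : Fin m → ℝ) :
    1 ≤ balancedDenom h a s z := by
  have : 0 ≤ h * ‖a‖ := by positivity
  have : 0 ≤ √h * ∑ r, ‖z r • s r‖ := by positivity
  unfold balancedDenom; linarith

theorem balancedIncr_eq (h : ℝ) (a : E) (s : Fin m → E) (z : Fin m → ℝ) :
    balancedIncr h a s z = (balancedDenom h a s z)⁻¹ • (h • a + √h • ∑ r, z r • s r) := by
  simp only [balancedIncr, Finset.smul_sum, smul_smul, mul_comm]

theorem sum_norm_smul_le (s : Fin m → E) (z : Fin m → ℝ) :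
    ∑ r, ‖z r • s r‖ ≤ (∑ r, ‖s r‖) * ∑ r, |z r| := by
  rw [Finset.mul_sum]
  refine Finset.sum_le_sum fun r _ => ?_
  rw [norm_smul, Real.norm_eq_abs, mul_comm]
  exact mul_le_mul_of_nonneg_right (Finset.single_le_sum (f := fun r => ‖s r‖)
    (fun _ _ => norm_nonneg _) (Finset.mem_univ r)) (abs_nonneg _)

/-- The denominator dominates the norm of the numerator by the triangle inequality. This is the
purpose of balancing, and it drives both the Taylor expansion and the crude growth bound. -/
theorem norm_balancedIncr_le_one {h : ℝ} (hh : 0 ≤ h) (a : E) (s : Fin m → E) (z : Fin m → ℝ) :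
    ‖balancedIncr h a s z‖ ≤ 1 := by
  have h1 := one_le_balancedDenom hh a s z
  rw [balancedIncr_eq, norm_smul, norm_inv, Real.norm_of_nonneg (by linarith),
    inv_mul_le_one₀ (by linarith)]
  calc ‖h • a + √h • ∑ r, z r • s r‖ ≤ ‖h • a‖ + ‖√h • ∑ r, z r • s r‖ := norm_add_le _ _
    _ ≤ h * ‖a‖ + √h * ∑ r, ‖z r • s r‖ := by
        rw [norm_smul, norm_smul, Real.norm_of_nonneg hh, Real.norm_of_nonneg (Real.sqrt_nonneg _)]
        gcongr
        exact norm_sum_le _ _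
    _ ≤ _ := by unfold balancedDenom; linarith

theorem norm_balancedIncr_le {h : ℝ} (hh : 0 ≤ h) (a : E) (s : Fin m → E) (z : Fin m → ℝ) :
    ‖balancedIncr h a s z‖ ≤ h * ‖a‖ + √h * ‖∑ r, z r • s r‖ := by
  have h1 := one_le_balancedDenom hh a s z
  rw [balancedIncr_eq, norm_smul, norm_inv, Real.norm_of_nonneg (by linarith)]
  calc _ ≤ 1 * ‖h • a + √h • ∑ r, z r • s r‖ :=
        mul_le_mul_of_nonneg_right (inv_le_one_of_one_le₀ h1) (norm_nonneg _)
    _ ≤ ‖h • a‖ + ‖√h • ∑ r, z r • s r‖ := by rw [one_mul]; exact norm_add_le _ _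
    _ = _ := by
        rw [norm_smul, norm_smul, Real.norm_of_nonneg hh, Real.norm_of_nonneg (Real.sqrt_nonneg _)]

/-- Young's inequality with unequal weights: the noise part competes with the coercivity constant,
so its factor must stay close to `1`, whereas the drift part is of order `h ^ 2` and can afford the
factor `9`. -/
theorem norm_balancedIncr_sq_le {h : ℝ} (hh : 0 ≤ h) (a : E) (s : Fin m → E) (z : Fin m → ℝ) :
    ‖balancedIncr h a s z‖ ^ 2 ≤ 9 / 8 * (h * ‖∑ r, z r • s r‖ ^ 2) + 9 * (h ^ 2 * ‖a‖ ^ 2) := by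
  have e : (√h * ‖∑ r, z r • s r‖) ^ 2 = h * ‖∑ r, z r • s r‖ ^ 2 := by
    rw [mul_pow, Real.sq_sqrt hh]
  calc _ ≤ (h * ‖a‖ + √h * ‖∑ r, z r • s r‖) ^ 2 := by
        gcongr; exact norm_balancedIncr_le hh a s z
    _ ≤ _ := by
        nlinarith [sq_nonneg (8 * (h * ‖a‖) - √h * ‖∑ r, z r • s r‖)]

theorem norm_balancedIncr_cube_le {h : ℝ} (hh : 0 ≤ h) (a : E) (s : Fin m → E) (z : Fin m → ℝ) :
    ‖balancedIncr h a s z‖ ^ 3 ≤ 4 * (h ^ 3 * ‖a‖ ^ 3)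
      + 4 * (h * √h * (∑ r, ‖s r‖) ^ 3 * (∑ r, |z r|) ^ 3) := by
  have e : (√h * ((∑ r, ‖s r‖) * ∑ r, |z r|)) ^ 3
      = h * √h * (∑ r, ‖s r‖) ^ 3 * (∑ r, |z r|) ^ 3 := by
    rw [mul_pow, mul_pow, pow_succ (√h), Real.sq_sqrt hh]; ring
  have hs : 0 ≤ √h * ((∑ r, ‖s r‖) * ∑ r, |z r|) := by positivity
  have ha : 0 ≤ h * ‖a‖ := by positivity
  calc _ ≤ (h * ‖a‖ + √h * ((∑ r, ‖s r‖) * ∑ r, |z r|)) ^ 3 := by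
        gcongr
        refine (norm_balancedIncr_le hh a s z).trans ?_
        gcongr
        exact (norm_sum_le _ _).trans (sum_norm_smul_le s z)
    _ ≤ 4 * ((h * ‖a‖) ^ 3 + (√h * ((∑ r, ‖s r‖) * ∑ r, |z r|)) ^ 3) :=
        (add_pow_le ha hs 3).trans_eq (by norm_num)
    _ = _ := by rw [e]; ring

/-- Removing the denominator `D` from the drift costs `1 - D⁻¹ ≤ D - 1`, which is small with `h`.
The noise term keeps its denominator: `D` is even in `z`, so the term remains odd and has mean zero.
-/
theorem inner_balancedIncr_le {h : ℝ} (hh : 0 ≤ h) (x a : E) (s : Fin m → E) (z : Fin m → ℝ) :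
    inner ℝ x (balancedIncr h a s z) ≤ h * inner ℝ x a
      + h * (h * (‖x‖ * ‖a‖ ^ 2) + ‖x‖ * ‖a‖ * √h * (∑ r, ‖s r‖) * ∑ r, |z r|)
      + √h * ((balancedDenom h a s z)⁻¹ * inner ℝ x (∑ r, z r • s r)) := by
  have h1 := one_le_balancedDenom hh a s z
  have hD0 : 0 < balancedDenom h a s z := by linarith
  rw [balancedIncr_eq, real_inner_smul_right, inner_add_right, real_inner_smul_right,
    real_inner_smul_right]
  have h2 : balancedDenom h a s z - 1 ≤ h * ‖a‖ + √h * ((∑ r, ‖s r‖) * ∑ r, |z r|) := by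
    have := mul_le_mul_of_nonneg_left (sum_norm_smul_le s z) (Real.sqrt_nonneg h)
    unfold balancedDenom; linarith
  have h3 : 1 - (balancedDenom h a s z)⁻¹ ≤ balancedDenom h a s z - 1 := by
    have := inv_mul_cancel₀ hD0.ne'
    have hinv := inv_pos.2 hD0
    nlinarith [sq_nonneg (balancedDenom h a s z - 1)]
  have h4 : (balancedDenom h a s z)⁻¹ * inner ℝ x a
      ≤ inner ℝ x a + ‖x‖ * ‖a‖ * (h * ‖a‖ + √h * ((∑ r, ‖s r‖) * ∑ r, |z r|)) := by
    have h5 := (abs_le.1 (abs_real_inner_le_norm x a)).1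
    have h6 : 0 ≤ 1 - (balancedDenom h a s z)⁻¹ := by
      linarith [inv_le_one_of_one_le₀ h1]
    have h7 := mul_le_mul_of_nonneg_right h5 h6
    have h8 := mul_le_mul_of_nonneg_left (h3.trans h2)
      (mul_nonneg (norm_nonneg x) (norm_nonneg a))
    linarith
  have h9 := mul_le_mul_of_nonneg_left h4 hh
  linarith

theorem continuous_balancedDenom (h : ℝ) (a : E) (s : Fin m → E) :
    Continuous (balancedDenom h a s) := by
  unfold balancedDenom; fun_prop

theorem integrable_inv_balancedDenom_mul_inner {h : ℝ} (hh : 0 ≤ h) (x a : E) (s : Fin m → E) :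
    Integrable (fun z => (balancedDenom h a s z)⁻¹ * inner ℝ x (∑ r, z r • s r))
      (stdGaussianPi m) := by
  have h1 := one_le_balancedDenom hh a s
  have hc : Continuous fun z => (balancedDenom h a s z)⁻¹ * inner ℝ x (∑ r, z r • s r) :=
    ((continuous_balancedDenom h a s).inv₀ fun z => by linarith [h1 z]).mul (by fun_prop)
  refine Integrable.mono' ((integrable_sum_abs_pow_stdGaussianPi m 1).const_mul
    (‖x‖ * ∑ r, ‖s r‖)) hc.aestronglyMeasurable (Filter.Eventually.of_forall fun z => ?_)
  rw [norm_mul, norm_inv, Real.norm_of_nonneg (by linarith [h1 z]), pow_one]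
  calc _ ≤ 1 * ‖inner ℝ x (∑ r, z r • s r)‖ :=
        mul_le_mul_of_nonneg_right (inv_le_one_of_one_le₀ (h1 z)) (norm_nonneg _)
    _ ≤ ‖x‖ * ‖∑ r, z r • s r‖ := by rw [one_mul]; exact norm_inner_le_norm _ _
    _ ≤ ‖x‖ * ((∑ r, ‖s r‖) * ∑ r, |z r|) := by
        gcongr; exact (norm_sum_le _ _).trans (sum_norm_smul_le s z)
    _ = _ := by ring

/-- The first order noise term of the balanced scheme is centred, by symmetry. -/
theorem integral_inv_balancedDenom_mul_inner (h : ℝ) (x a : E) (s : Fin m → E) :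
    ∫ z, (balancedDenom h a s z)⁻¹ * inner ℝ x (∑ r, z r • s r) ∂stdGaussianPi m = 0 := by
  have := integral_neg_eq_self
    (fun z => (balancedDenom h a s z)⁻¹ * inner ℝ x (∑ r, z r • s r)) (stdGaussianPi m)
  simp only [balancedDenom, Pi.neg_apply, neg_smul, norm_neg, Finset.sum_neg_distrib,
    inner_neg_right, mul_neg, integral_neg] at this
  unfold balancedDenom
  linarith

/-- One step of the balanced scheme increases the moment of order `2 * q` by a factor of at most
`1 + O(h)`, at points where the coefficients are small relative to the step size. -/
theorem exists_lintegral_balancedIncr_le (q m : ℕ) (hq : 1 ≤ q) {C : ℝ} (hC : 0 ≤ C) :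
    ∃ K : ℝ, 0 ≤ K ∧ ∀ (h : ℝ) (x a : E) (s : Fin m → E), 0 ≤ h →
      inner ℝ x a + 9 / 8 * (q - 1 / 2) * ∑ r, ‖s r‖ ^ 2 ≤ C * (1 + ‖x‖ ^ 2) →
      h * ((1 + ‖x‖) * ‖a‖ ^ 2) ≤ C * (1 + ‖x‖ ^ 2) →
      ‖x‖ * ‖a‖ * √h * ∑ r, ‖s r‖ ≤ C * (1 + ‖x‖ ^ 2) →
      √h * (∑ r, ‖s r‖) ^ 3 ≤ C * (1 + ‖x‖ ^ 2) →
      h ^ 2 * ‖a‖ ^ 3 ≤ C * (1 + ‖x‖ ^ 2) →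
      ∫⁻ z, ENNReal.ofReal ((1 + ‖x + balancedIncr h a s z‖ ^ 2) ^ q) ∂stdGaussianPi m
        ≤ ENNReal.ofReal ((1 + K * h) * (1 + ‖x‖ ^ 2) ^ q) := by
  obtain ⟨B, hB, hTaylor⟩ := exists_one_add_norm_sq_pow_le (E := E) q hq
  set M₁ := ∫ z : Fin m → ℝ, (∑ r, |z r|) ^ 1 ∂stdGaussianPi m
  set M₃ := ∫ z : Fin m → ℝ, (∑ r, |z r|) ^ 3 ∂stdGaussianPi m
  have hM₁ : 0 ≤ M₁ := integral_nonneg fun z => by positivity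
  have hM₃ : 0 ≤ M₃ := integral_nonneg fun z => by positivity
  have hq1 : (1 : ℝ) ≤ q := by exact_mod_cast hq
  refine ⟨2 * q * C + 2 * q * (C * (1 + M₁)) + 18 * q * q * C + 4 * B * (C * (1 + M₃)),
    by positivity, fun h x a s hh H1 H2 H3 H4 H5 => ?_⟩
  have hV1 : 1 ≤ 1 + ‖x‖ ^ 2 := by linarith [sq_nonneg ‖x‖]
  generalize hV : 1 + ‖x‖ ^ 2 = V at *
  set S := ∑ r, ‖s r‖
  have hS : 0 ≤ S := Finset.sum_nonneg fun _ _ => norm_nonneg _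
  -- A majorant grouped by its dependence on `z`: a constant, the first absolute moment, the odd
  -- term, the quadratic noise and the third absolute moment. Each group has a known or finite
  -- integral.
  set g : (Fin m → ℝ) → ℝ := fun z => V ^ (q - 1) *
    ((V + 2 * q * (h * inner ℝ x a) + 2 * q * (h * (h * (‖x‖ * ‖a‖ ^ 2)))
        + 18 * q * (q - 1 / 2) * (h ^ 2 * ‖a‖ ^ 2) + 4 * B * (h ^ 3 * ‖a‖ ^ 3))
      + (2 * q * h * (‖x‖ * ‖a‖ * √h * S)) * (∑ r, |z r|) ^ 1
      + (2 * q * √h) * ((balancedDenom h a s z)⁻¹ * inner ℝ x (∑ r, z r • s r))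
      + (2 * q * (q - 1 / 2) * (9 / 8) * h) * ‖∑ r, z r • s r‖ ^ 2
      + (4 * B * (h * √h * S ^ 3)) * (∑ r, |z r|) ^ 3) with hg
  have hfg : ∀ z, (1 + ‖x + balancedIncr h a s z‖ ^ 2) ^ q ≤ g z := fun z => by
    refine (hTaylor x _ (norm_balancedIncr_le_one hh a s z)).trans ?_
    rw [hV]
    refine mul_le_mul_of_nonneg_left ?_ (by positivity)
    have i1 := mul_le_mul_of_nonneg_left (inner_balancedIncr_le hh x a s z)
      (by positivity : (0 : ℝ) ≤ 2 * q)
    have i2 := mul_le_mul_of_nonneg_left (norm_balancedIncr_sq_le hh a s z)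
      (by have : (0 : ℝ) ≤ q - 1 / 2 := by linarith
          positivity : (0 : ℝ) ≤ 2 * q * (q - 1 / 2))
    have i3 := mul_le_mul_of_nonneg_left (norm_balancedIncr_cube_le hh a s z) hB
    rw [pow_one]
    linarith
  have I1 := (integrable_sum_abs_pow_stdGaussianPi m 1).const_mul
    (2 * q * h * (‖x‖ * ‖a‖ * √h * S))
  have I2 := (integrable_inv_balancedDenom_mul_inner hh x a s).const_mul (2 * q * √h)
  have I3 := (integrable_norm_sum_smul_sq s).const_mul (2 * q * (q - 1 / 2) * (9 / 8) * h)
  have I4 := (integrable_sum_abs_pow_stdGaussianPi m 3).const_mul (4 * B * (h * √h * S ^ 3))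
  set c₀ := V + 2 * q * (h * inner ℝ x a) + 2 * q * (h * (h * (‖x‖ * ‖a‖ ^ 2)))
        + 18 * q * (q - 1 / 2) * (h ^ 2 * ‖a‖ ^ 2) + 4 * B * (h ^ 3 * ‖a‖ ^ 3) with hc₀
  have I0 : Integrable (fun _ : Fin m → ℝ => c₀) (stdGaussianPi m) := integrable_const _
  have hgi : Integrable g (stdGaussianPi m) :=
    ((((I0.fun_add I1).fun_add I2).fun_add I3).fun_add I4).const_mul _
  have hgint : ∫ z, g z ∂stdGaussianPi m = V ^ (q - 1) * (c₀
      + (2 * q * h * (‖x‖ * ‖a‖ * √h * S)) * M₁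
      + (2 * q * (q - 1 / 2) * (9 / 8) * h) * ∑ r, ‖s r‖ ^ 2
      + (4 * B * (h * √h * S ^ 3)) * M₃) := by
    rw [hg, integral_const_mul, integral_add (((I0.fun_add I1).fun_add I2).fun_add I3) I4,
      integral_add ((I0.fun_add I1).fun_add I2) I3, integral_add (I0.fun_add I1) I2, integral_add I0 I1,
      integral_const_mul, integral_const_mul, integral_const_mul, integral_const_mul,
      integral_inv_balancedDenom_mul_inner, integral_norm_sum_smul_sq]
    simp [M₁, M₃]
  calc _ ≤ ∫⁻ z, ENNReal.ofReal (g z) ∂stdGaussianPi m :=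
        lintegral_mono fun z => ENNReal.ofReal_le_ofReal (hfg z)
    _ = ENNReal.ofReal (∫ z, g z ∂stdGaussianPi m) :=
        (ofReal_integral_eq_lintegral_ofReal hgi (Filter.Eventually.of_forall fun z =>
          (show (0 : ℝ) ≤ (1 + ‖x + balancedIncr h a s z‖ ^ 2) ^ q by positivity).trans (hfg z))).symm
    _ ≤ _ := by
        refine ENNReal.ofReal_le_ofReal ?_
        rw [hgint, show (V : ℝ) ^ q = V ^ (q - 1) * V by rw [← pow_succ, Nat.sub_add_cancel hq],
          mul_left_comm (1 + _ * h)]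
        refine mul_le_mul_of_nonneg_left ?_ (by positivity)
        have hCV : (0 : ℝ) ≤ C * V := by positivity
        have hx := norm_nonneg x
        -- The drift term and the integrated quadratic noise combine into exactly `2 * q * h` times
        -- the left side of `H1`.
        have j1 := mul_le_mul_of_nonneg_left H1 (by positivity : (0 : ℝ) ≤ 2 * q * h)
        have H2a : h * (‖x‖ * ‖a‖ ^ 2) ≤ C * V := by
          refine le_trans ?_ H2
          gcongr
          linarith
        have H2b : h * ‖a‖ ^ 2 ≤ C * V := by
          refine le_trans ?_ H2
          gcongr
          exact le_mul_of_one_le_left (by positivity) (by linarith)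
        have j2 := mul_le_mul_of_nonneg_left H2a (by positivity : (0 : ℝ) ≤ 2 * q * h)
        have j3 := mul_le_mul_of_nonneg_left H2b (by positivity : (0 : ℝ) ≤ 18 * q * q * h)
        have j3' : 18 * q * (q - 1 / 2) * (h ^ 2 * ‖a‖ ^ 2)
            ≤ 18 * q * q * h * (h * ‖a‖ ^ 2) := by
          have : (0 : ℝ) ≤ 9 * q * (h ^ 2 * ‖a‖ ^ 2) := by positivity
          linarith
        have j4 := mul_le_mul_of_nonneg_left H3 (by positivity : (0 : ℝ) ≤ 2 * q * h * M₁)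
        have j5 := mul_le_mul_of_nonneg_left H4 (by positivity : (0 : ℝ) ≤ 4 * B * h * M₃)
        have j6 := mul_le_mul_of_nonneg_left H5 (by positivity : (0 : ℝ) ≤ 4 * B * h)
        rw [hc₀]
        linarith

end Increment

/-! ### Continuity, growth and coercivity of the coefficients. -/

section Coefficients

variable {d m : ℕ} {a : ℝ → EuclideanSpace ℝ (Fin d) → EuclideanSpace ℝ (Fin d)}
  {σ : Fin m → ℝ → EuclideanSpace ℝ (Fin d) → EuclideanSpace ℝ (Fin d)} {t₀ T p₀ ϰ : ℝ}

theorem continuous_of_norm_sub_sq_le {E F : Type*} [TopologicalSpace E] [NormedAddCommGroup F]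
    {f : E → F} (h : ∀ y, ∃ g : E → ℝ, Continuous g ∧ g y = 0 ∧ ∀ x, ‖f x - f y‖ ^ 2 ≤ g x) :
    Continuous f := by
  rw [continuous_iff_continuousAt]
  intro y
  obtain ⟨g, hg, hgy, hfg⟩ := h y
  rw [ContinuousAt, tendsto_iff_norm_sub_tendsto_zero]
  have h1 : Filter.Tendsto (fun x => √(g x)) (nhds y) (nhds 0) := by
    have := (Real.continuous_sqrt.comp hg).tendsto y
    simpa [hgy, Function.comp_def] using this
  exact squeeze_zero (fun _ => norm_nonneg _) (fun x => Real.le_sqrt_of_sq_le (hfg x)) h1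

theorem OneSidedLipschitzCoeffs.continuous_drift (hc : OneSidedLipschitzCoeffs a σ t₀ T p₀ ϰ)
    {t : ℝ} (ht : t ∈ Set.Icc t₀ T) : Continuous (a t) := by
  obtain ⟨c₂, -, h⟩ := hc.poly_lipschitz
  have hϰ : 0 ≤ 2 * ϰ - 2 := by linarith [hc.one_le_ϰ]
  refine continuous_of_norm_sub_sq_le fun y => ⟨_, ?_, ?_, fun x => h t ht x y⟩
  · have : Continuous fun x : EuclideanSpace ℝ (Fin d) => ‖x‖ ^ (2 * ϰ - 2) :=
      continuous_norm.rpow_const fun _ => Or.inr hϰ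
    fun_prop
  · simp

/-- Since `p₀ ≥ 1`, the factor `(2 * p₀ - 1) / 2` is at least `1 / 2`, and Cauchy–Schwarz bounds the
inner product from below. The diffusion thus inherits continuity and growth from the drift. -/
theorem OneSidedLipschitzCoeffs.exists_sum_norm_sub_sq_le
    (hc : OneSidedLipschitzCoeffs a σ t₀ T p₀ ϰ) :
    ∃ c : ℝ, 0 ≤ c ∧ ∀ t ∈ Set.Icc t₀ T, ∀ x y, ∑ r, ‖σ r t x - σ r t y‖ ^ 2
      ≤ c * ‖x - y‖ ^ 2 + 2 * (‖x - y‖ * ‖a t x - a t y‖) := by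
  obtain ⟨c₁, hc₁, h⟩ := hc.one_sided
  refine ⟨2 * c₁, by positivity, fun t ht x y => ?_⟩
  have h1 := h t ht x y
  have h2 := (abs_le.1 (abs_real_inner_le_norm (x - y) (a t x - a t y))).1
  have h3 : 0 ≤ ∑ r, ‖σ r t x - σ r t y‖ ^ 2 := by positivity
  have h4 := mul_le_mul_of_nonneg_right hc.one_le_p₀ h3
  linarith

theorem OneSidedLipschitzCoeffs.continuous_diffusion
    (hc : OneSidedLipschitzCoeffs a σ t₀ T p₀ ϰ) {t : ℝ} (ht : t ∈ Set.Icc t₀ T) (r : Fin m) :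
    Continuous (σ r t) := by
  obtain ⟨c, -, h⟩ := hc.exists_sum_norm_sub_sq_le
  have ha := hc.continuous_drift ht
  refine continuous_of_norm_sub_sq_le fun y => ⟨_, ?_, ?_, fun x =>
    (Finset.single_le_sum (f := fun r => ‖σ r t x - σ r t y‖ ^ 2)
      (fun _ _ => by positivity) (Finset.mem_univ r)).trans (h t ht x y)⟩
  · fun_prop
  · simp

theorem OneSidedLipschitzCoeffs.exists_norm_drift_sub_sq_le
    (hc : OneSidedLipschitzCoeffs a σ t₀ T p₀ ϰ) :
    ∃ c : ℝ, 0 ≤ c ∧ ∀ t ∈ Set.Icc t₀ T, ∀ x,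
      ‖a t x - a t 0‖ ^ 2 ≤ c * (1 + ‖x‖ ^ 2) ^ ϰ := by
  obtain ⟨c₂, hc₂, h⟩ := hc.poly_lipschitz
  have hϰ := hc.one_le_ϰ
  refine ⟨3 * c₂, by positivity, fun t ht x => (h t ht x 0).trans ?_⟩
  have hV1 : 1 ≤ 1 + ‖x‖ ^ 2 := by linarith [sq_nonneg ‖x‖]
  have h1 : ‖x‖ ^ (2 * ϰ - 2) ≤ (1 + ‖x‖ ^ 2) ^ (ϰ - 1) := by
    rw [show 2 * ϰ - 2 = 2 * (ϰ - 1) by ring, Real.rpow_mul (norm_nonneg x), Real.rpow_two]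
    exact Real.rpow_le_rpow (by positivity) (by linarith) (by linarith)
  -- Only `≤ 1` holds in general: for `ϰ = 1` the power is `0 ^ 0 = 1`.
  have h2 : ‖(0 : EuclideanSpace ℝ (Fin d))‖ ^ (2 * ϰ - 2) ≤ 1 :=
    Real.rpow_le_one (norm_nonneg _) (by simp) (by linarith)
  have h3 : 1 ≤ (1 + ‖x‖ ^ 2) ^ (ϰ - 1) := Real.one_le_rpow hV1 (by linarith)
  have h4 : (1 + ‖x‖ ^ 2) ^ ϰ = (1 + ‖x‖ ^ 2) ^ (ϰ - 1) * (1 + ‖x‖ ^ 2) := by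
    rw [← Real.rpow_add_one (by positivity)]; ring_nf
  rw [h4, sub_zero]
  calc _ ≤ c₂ * (3 * (1 + ‖x‖ ^ 2) ^ (ϰ - 1)) * (1 + ‖x‖ ^ 2) := by
        gcongr
        · linarith
        · linarith
    _ = _ := by ring

/-- The diffusion exponent is the mean of `1` and `ϰ`: the squared diffusion increment is controlled
by `‖x‖ * ‖a t x - a t 0‖`, that is by `V ^ (1 / 2) * V ^ (ϰ / 2)` with `V = 1 + ‖x‖ ^ 2`. -/
theorem OneSidedLipschitzCoeffs.exists_growth (hc : OneSidedLipschitzCoeffs a σ t₀ T p₀ ϰ)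
    (hb : BoundedAtOrigin a σ t₀ T) :
    ∃ L : ℝ, 1 ≤ L ∧ ∀ t ∈ Set.Icc t₀ T, ∀ x, ‖a t x‖ ^ 2 ≤ L * (1 + ‖x‖ ^ 2) ^ ϰ ∧
      (∑ r, ‖σ r t x‖) ^ 2 ≤ L * (1 + ‖x‖ ^ 2) ^ ((ϰ + 1) / 2) := by
  obtain ⟨c, hc0, hdrift⟩ := hc.exists_norm_drift_sub_sq_le
  obtain ⟨b, hb0, hdiff⟩ := hc.exists_sum_norm_sub_sq_le
  obtain ⟨M, hM⟩ := hb
  have hϰ := hc.one_le_ϰ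
  set L₁ := 2 * M ^ 2 + 2 * c
  set L₂ := m * (2 * (b + 2 * √c) + 2 * (m * M ^ 2))
  refine ⟨1 + L₁ + L₂, by have : 0 ≤ L₁ + L₂ := by positivity
                          linarith, fun t ht x => ?_⟩
  obtain ⟨hMa, hMσ⟩ := hM t ht
  have hV1 : 1 ≤ 1 + ‖x‖ ^ 2 := by linarith [sq_nonneg ‖x‖]
  have hxV : ‖x‖ ^ 2 ≤ 1 + ‖x‖ ^ 2 := by linarith
  have hd := hdrift t ht x
  have hs := hdiff t ht x 0
  rw [sub_zero] at hs
  generalize 1 + ‖x‖ ^ 2 = V at *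
  have hV0 : 0 < V := by linarith
  have hL₁ : 0 ≤ L₁ := by positivity
  have hL₂ : 0 ≤ L₂ := by positivity
  constructor
  · have h1 : 1 ≤ V ^ ϰ := Real.one_le_rpow hV1 (by linarith)
    have h2 : ‖a t x‖ ^ 2 ≤ 2 * ‖a t x - a t 0‖ ^ 2 + 2 * ‖a t 0‖ ^ 2 := by
      have := norm_add_le (a t x - a t 0) (a t 0)
      rw [sub_add_cancel] at this
      have h3 : ‖a t x‖ ^ 2 ≤ (‖a t x - a t 0‖ + ‖a t 0‖) ^ 2 := by gcongr
      linarith [sq_nonneg (‖a t x - a t 0‖ - ‖a t 0‖)]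
    have h3 : ‖a t 0‖ ^ 2 ≤ M ^ 2 := by gcongr
    have h4 : M ^ 2 ≤ M ^ 2 * V ^ ϰ := le_mul_of_one_le_right (sq_nonneg _) h1
    have h5 : 0 ≤ (1 + L₂) * V ^ ϰ := by positivity
    linarith
  · have h1 : 1 ≤ V ^ ((ϰ + 1) / 2) := Real.one_le_rpow hV1 (by linarith)
    have h1' : V ≤ V ^ ((ϰ + 1) / 2) := by
      simpa using Real.rpow_le_rpow_of_exponent_le hV1 (by linarith : 1 ≤ (ϰ + 1) / 2)
    have e1 : V * V ^ ϰ = (V ^ ((ϰ + 1) / 2)) ^ 2 := by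
      rw [← Real.rpow_two, ← Real.rpow_mul hV0.le, ← Real.rpow_one_add' hV0.le (by linarith)]
      ring_nf
    generalize V ^ ((ϰ + 1) / 2) = W at *
    have h2 : ‖x‖ * ‖a t x - a t 0‖ ≤ √c * W := by
      refine abs_le_of_sq_le_sq' ?_ (by positivity) |>.2
      rw [mul_pow, mul_pow, Real.sq_sqrt hc0, ← e1]
      calc _ ≤ V * (c * V ^ ϰ) := by gcongr
        _ = _ := by ring
    have h3 : ∑ r, ‖σ r t x - σ r t 0‖ ^ 2 ≤ (b + 2 * √c) * W := by
      have : b * ‖x‖ ^ 2 ≤ b * W := by gcongr; linarith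
      linarith
    have h4 : ∑ r, ‖σ r t x‖ ^ 2 ≤ 2 * ∑ r, ‖σ r t x - σ r t 0‖ ^ 2 + 2 * (m * M ^ 2) := by
      calc _ ≤ ∑ r, (2 * ‖σ r t x - σ r t 0‖ ^ 2 + 2 * M ^ 2) := by
            refine Finset.sum_le_sum fun r _ => ?_
            have := norm_add_le (σ r t x - σ r t 0) (σ r t 0)
            rw [sub_add_cancel] at this
            have h3 : ‖σ r t x‖ ^ 2 ≤ (‖σ r t x - σ r t 0‖ + M) ^ 2 := by
              gcongr
              exact this.trans (by gcongr; exact hMσ r)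
            linarith [sq_nonneg (‖σ r t x - σ r t 0‖ - M)]
        _ = _ := by
            rw [Finset.sum_add_distrib, ← Finset.mul_sum]
            simp; ring
    have h5 : (∑ r, ‖σ r t x‖) ^ 2 ≤ m * ∑ r, ‖σ r t x‖ ^ 2 := by
      simpa using sq_sum_le_card_mul_sum_sq (s := Finset.univ) (f := fun r => ‖σ r t x‖)
    refine h5.trans ?_
    calc (m : ℝ) * ∑ r, ‖σ r t x‖ ^ 2
        ≤ m * (2 * ((b + 2 * √c) * W) + 2 * (m * M ^ 2) * W) := by
          gcongr
          have : 2 * (m * M ^ 2) ≤ 2 * (m * M ^ 2) * W :=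
            le_mul_of_one_le_right (by positivity) h1
          linarith
      _ = L₂ * W := by simp only [L₂]; ring
      _ ≤ _ := by gcongr; linarith

/-- The one-sided condition is applied against the origin. Replacing `σ r t x - σ r t 0` by `σ r t
x` costs a factor `9 / 8` on the main part, which is the loss allowed for in `hθ'`. -/
theorem OneSidedLipschitzCoeffs.exists_coercive (hc : OneSidedLipschitzCoeffs a σ t₀ T p₀ ϰ)
    (hb : BoundedAtOrigin a σ t₀ T) {θ : ℝ} (hθ : 0 ≤ θ) (hθ' : 9 / 8 * θ ≤ p₀ - 1 / 2) :
    ∃ C : ℝ, 0 ≤ C ∧ ∀ t ∈ Set.Icc t₀ T, ∀ x,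
      inner ℝ x (a t x) + θ * ∑ r, ‖σ r t x‖ ^ 2 ≤ C * (1 + ‖x‖ ^ 2) := by
  obtain ⟨c₁, hc₁, h⟩ := hc.one_sided
  obtain ⟨M, hM⟩ := hb
  refine ⟨c₁ + |M| + 9 * θ * (m * M ^ 2), by positivity, fun t ht x => ?_⟩
  obtain ⟨hMa, hMσ⟩ := hM t ht
  have h0 := h t ht x 0
  rw [sub_zero, inner_sub_right] at h0
  have h1 : inner ℝ x (a t 0) ≤ |M| * (1 + ‖x‖ ^ 2) := by
    calc _ ≤ ‖x‖ * ‖a t 0‖ := real_inner_le_norm _ _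
      _ ≤ (1 + ‖x‖ ^ 2) * |M| := by
        gcongr
        · nlinarith [sq_nonneg (‖x‖ - 1)]
        · exact hMa.trans (le_abs_self M)
      _ = _ := mul_comm _ _
  have h4 : ∑ r, ‖σ r t x‖ ^ 2
      ≤ 9 / 8 * ∑ r, ‖σ r t x - σ r t 0‖ ^ 2 + 9 * (m * M ^ 2) := by
    calc _ ≤ ∑ r, (9 / 8 * ‖σ r t x - σ r t 0‖ ^ 2 + 9 * M ^ 2) := by
          refine Finset.sum_le_sum fun r _ => ?_
          have := norm_add_le (σ r t x - σ r t 0) (σ r t 0)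
          rw [sub_add_cancel] at this
          have h3 : ‖σ r t x‖ ^ 2 ≤ (‖σ r t x - σ r t 0‖ + M) ^ 2 := by
            gcongr
            exact this.trans (by gcongr; exact hMσ r)
          linarith [sq_nonneg (‖σ r t x - σ r t 0‖ - 8 * M)]
      _ = _ := by
          rw [Finset.sum_add_distrib, ← Finset.mul_sum]
          simp; ring
  have h5 := mul_le_mul_of_nonneg_left h4 hθ
  have h6 : 0 ≤ ∑ r, ‖σ r t x - σ r t 0‖ ^ 2 := by positivity
  have h7 := mul_le_mul_of_nonneg_right hθ' h6
  have h8 : 0 ≤ 9 * θ * (m * M ^ 2) * ‖x‖ ^ 2 := by positivity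
  linarith

/-- The coefficients satisfy the smallness conditions of the one-step estimate wherever
`h * (1 + ‖x‖ ^ 2) ^ ((3 * ϰ - 1) / 2) ≤ 1`. -/
theorem OneSidedLipschitzCoeffs.exists_small_step_bounds
    (hc : OneSidedLipschitzCoeffs a σ t₀ T p₀ ϰ) (hb : BoundedAtOrigin a σ t₀ T) :
    ∃ C : ℝ, 0 ≤ C ∧ ∀ t ∈ Set.Icc t₀ T, ∀ x, ∀ h : ℝ, 0 ≤ h →
      h * (1 + ‖x‖ ^ 2) ^ ((3 * ϰ - 1) / 2) ≤ 1 →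
      h * ((1 + ‖x‖) * ‖a t x‖ ^ 2) ≤ C * (1 + ‖x‖ ^ 2) ∧
      ‖x‖ * ‖a t x‖ * √h * ∑ r, ‖σ r t x‖ ≤ C * (1 + ‖x‖ ^ 2) ∧
      √h * (∑ r, ‖σ r t x‖) ^ 3 ≤ C * (1 + ‖x‖ ^ 2) ∧
      h ^ 2 * ‖a t x‖ ^ 3 ≤ C * (1 + ‖x‖ ^ 2) := by
  obtain ⟨L, hL, hgrowth⟩ := hc.exists_growth hb
  have hϰ := hc.one_le_ϰ
  refine ⟨2 * L ^ 2, by positivity, fun t ht x h hh hsmall => ?_⟩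
  obtain ⟨hA, hS⟩ := hgrowth t ht x
  have hA0 := norm_nonneg (a t x)
  have hS0 : 0 ≤ ∑ r, ‖σ r t x‖ := Finset.sum_nonneg fun _ _ => norm_nonneg _
  have hV1 : 1 ≤ 1 + ‖x‖ ^ 2 := by linarith [sq_nonneg ‖x‖]
  have hxV : ‖x‖ ^ 2 ≤ 1 + ‖x‖ ^ 2 := by linarith
  have hx0 := norm_nonneg x
  generalize ‖a t x‖ = A at *
  generalize ∑ r, ‖σ r t x‖ = S at *
  generalize ‖x‖ = X at *
  generalize 1 + X ^ 2 = V at *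
  have hV0 : 0 < V := by linarith
  have hL2 : L ≤ 2 * L ^ 2 := by nlinarith
  have hL3 : L ^ 2 ≤ (2 * L ^ 2) ^ 2 := by gcongr
  have hL3' : L ^ 3 ≤ (2 * L ^ 2) ^ 2 := by
    have : L ^ 3 ≤ L ^ 4 := pow_le_pow_right₀ hL (by norm_num)
    have : 0 ≤ L ^ 4 := by positivity
    nlinarith
  -- Exponent bookkeeping for the four claims. The threshold exponent `(3 * ϰ - 1) / 2` is dictated
  -- by `e1` and `e2`, the squares of the mixed drift–noise term and of the cubic noise term; the
  -- other two claims have room to spare.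
  have eR : V ^ (1 / 2 : ℝ) * V ^ ϰ ≤ V * V ^ ((3 * ϰ - 1) / 2) := by
    rw [← Real.rpow_add hV0, ← Real.rpow_one_add' hV0.le (by linarith)]
    exact Real.rpow_le_rpow_of_exponent_le hV1 (by linarith)
  have e1 : V * V ^ ϰ * V ^ ((ϰ + 1) / 2) = V ^ 2 * V ^ ((3 * ϰ - 1) / 2) := by
    rw [← Real.rpow_two, ← Real.rpow_add hV0, ← Real.rpow_one_add' hV0.le (by linarith),
      ← Real.rpow_add hV0]
    ring_nf
  have e2 : (V ^ ((ϰ + 1) / 2)) ^ 3 = V ^ 2 * V ^ ((3 * ϰ - 1) / 2) := by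
    rw [← Real.rpow_two, ← Real.rpow_natCast, ← Real.rpow_add hV0, ← Real.rpow_mul hV0.le]
    push_cast
    ring_nf
  have e3 : (V ^ ϰ) ^ 3 = V * (V ^ ((3 * ϰ - 1) / 2)) ^ 2 := by
    rw [← Real.rpow_two, ← Real.rpow_natCast, ← Real.rpow_mul hV0.le, ← Real.rpow_mul hV0.le,
      ← Real.rpow_one_add' hV0.le (by linarith)]
    push_cast
    ring_nf
  have hXV : 1 + X ≤ 2 * V ^ (1 / 2 : ℝ) := by
    rw [← Real.sqrt_eq_rpow]
    have h1 : 1 ≤ √V := Real.one_le_sqrt.2 hV1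
    have h2 : X ≤ √V := Real.le_sqrt_of_sq_le hxV
    linarith
  have hW1 : 1 ≤ V ^ ((3 * ϰ - 1) / 2) := Real.one_le_rpow hV1 (by linarith)
  have hP0 : 0 ≤ V ^ ϰ := by positivity
  have hQ0 : 0 ≤ V ^ ((ϰ + 1) / 2) := by positivity
  have hR0 : 0 ≤ V ^ (1 / 2 : ℝ) := by positivity
  generalize V ^ ((3 * ϰ - 1) / 2) = W at *
  generalize V ^ ((ϰ + 1) / 2) = Q at *
  generalize V ^ ϰ = P at *
  generalize V ^ (1 / 2 : ℝ) = R at *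
  have hh1 : h ≤ 1 := (le_mul_of_one_le_right hh hW1).trans hsmall
  have hsq := Real.sq_sqrt hh
  refine ⟨?_, ?_, ?_, ?_⟩
  · calc h * ((1 + X) * A ^ 2) ≤ h * ((2 * R) * (L * P)) := by gcongr
      _ = 2 * L * (h * (R * P)) := by ring
      _ ≤ 2 * L * (h * (V * W)) := by gcongr
      _ = 2 * L * V * (h * W) := by ring
      _ ≤ 2 * L * V * 1 := by gcongr
      _ = 2 * L * V := mul_one _
      _ ≤ 2 * L ^ 2 * V := by gcongr; nlinarith
  · refine (abs_le_of_sq_le_sq' ?_ (by positivity)).2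
    calc (X * A * √h * S) ^ 2 = X ^ 2 * A ^ 2 * h * S ^ 2 := by rw [← hsq]; simp; ring
      _ ≤ V * (L * P) * h * (L * Q) := by gcongr
      _ = L ^ 2 * h * (V * P * Q) := by ring
      _ = L ^ 2 * V ^ 2 * (h * W) := by rw [e1]; ring
      _ ≤ (2 * L ^ 2) ^ 2 * V ^ 2 * 1 := by gcongr
      _ = _ := by ring
  · refine (abs_le_of_sq_le_sq' ?_ (by positivity)).2
    calc (√h * S ^ 3) ^ 2 = h * (S ^ 2) ^ 3 := by rw [mul_pow, hsq]; ring
      _ ≤ h * (L * Q) ^ 3 := by gcongr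
      _ = L ^ 3 * V ^ 2 * (h * W) := by rw [mul_pow, e2]; ring
      _ ≤ (2 * L ^ 2) ^ 2 * V ^ 2 * 1 := by gcongr
      _ = _ := by ring
  · refine (abs_le_of_sq_le_sq' ?_ (by positivity)).2
    calc (h ^ 2 * A ^ 3) ^ 2 = h ^ 4 * (A ^ 2) ^ 3 := by ring
      _ ≤ h ^ 4 * (L * P) ^ 3 := by gcongr
      _ = L ^ 3 * (V * h ^ 2) * (h * W) ^ 2 := by rw [mul_pow, e3]; ring
      _ ≤ (2 * L ^ 2) ^ 2 * (V * V) * 1 ^ 2 := by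
        gcongr
        exact (pow_le_one₀ hh hh1).trans hV1
      _ = _ := by ring

end Coefficients

/-! ### Backward recursion for the expectations of the scheme. -/

section Scheme

variable {d m : ℕ} {a : ℝ → EuclideanSpace ℝ (Fin d) → EuclideanSpace ℝ (Fin d)}
  {σ : Fin m → ℝ → EuclideanSpace ℝ (Fin d) → EuclideanSpace ℝ (Fin d)} {t₀ T p₀ ϰ : ℝ}

theorem balancedStep_eq_add_balancedIncr (h t : ℝ) (x : EuclideanSpace ℝ (Fin d))
    (z : Fin m → ℝ) :
    balancedStep a σ h t x z = x + balancedIncr h (a t x) (fun r => σ r t x) z := rfl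

theorem continuous_balancedStep {h t : ℝ} (hh : 0 ≤ h) (ha : Continuous (a t))
    (hσ : ∀ r, Continuous (σ r t)) :
    Continuous fun y : EuclideanSpace ℝ (Fin d) × (Fin m → ℝ) =>
      balancedStep a σ h t y.1 y.2 := by
  unfold balancedStep
  have h1 : Continuous fun y : EuclideanSpace ℝ (Fin d) × (Fin m → ℝ) =>
      (1 + h * ‖a t y.1‖ + √h * ∑ r, ‖y.2 r • σ r t y.1‖)⁻¹ :=
    Continuous.inv₀ (by fun_prop) fun y => (zero_lt_one.trans_le
      (one_le_balancedDenom hh (a t y.1) (fun r => σ r t y.1) y.2)).ne'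
  fun_prop

/-- The expected value of `f` after `n` steps of the balanced scheme of step size `h`, started
from `x` at the `j`-th grid point. -/
noncomputable def schemeExpectation
    (a : ℝ → EuclideanSpace ℝ (Fin d) → EuclideanSpace ℝ (Fin d))
    (σ : Fin m → ℝ → EuclideanSpace ℝ (Fin d) → EuclideanSpace ℝ (Fin d)) (t₀ h : ℝ)
    (f : EuclideanSpace ℝ (Fin d) → ENNReal) : ℕ → ℕ → EuclideanSpace ℝ (Fin d) → ENNReal
  | 0, _, x => f x
  | n + 1, j, x => ∫⁻ z, schemeExpectation a σ t₀ h f n (j + 1)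
      (balancedStep a σ h (t₀ + j * h) x z) ∂stdGaussianPi m

theorem grid_mem_Icc {N j : ℕ} (hT : t₀ ≤ T) (hj : j < N) :
    t₀ + j * ((T - t₀) / N) ∈ Set.Icc t₀ T := by
  have hN : (0 : ℝ) < N := by exact_mod_cast (Nat.zero_le j).trans_lt hj
  have hjN : (j : ℝ) ≤ N := by exact_mod_cast hj.le
  have h0 : 0 ≤ T - t₀ := by linarith
  constructor
  · have : 0 ≤ j * ((T - t₀) / N) := by positivity
    linarith
  · have : j * ((T - t₀) / N) ≤ N * ((T - t₀) / N) := by gcongr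
    rw [mul_div_cancel₀ _ hN.ne'] at this
    linarith

theorem measurable_balancedStep (hc : OneSidedLipschitzCoeffs a σ t₀ T p₀ ϰ) (hT : t₀ ≤ T)
    {N j : ℕ} (hj : j < N) :
    Measurable fun y : EuclideanSpace ℝ (Fin d) × (Fin m → ℝ) =>
      balancedStep a σ ((T - t₀) / N) (t₀ + j * ((T - t₀) / N)) y.1 y.2 :=
  (continuous_balancedStep (div_nonneg (by linarith) (by positivity))
    (hc.continuous_drift (grid_mem_Icc hT hj))
    (hc.continuous_diffusion (grid_mem_Icc hT hj))).measurable

theorem measurable_schemeExpectation (hc : OneSidedLipschitzCoeffs a σ t₀ T p₀ ϰ) (hT : t₀ ≤ T)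
    {f : EuclideanSpace ℝ (Fin d) → ENNReal} (hf : Measurable f) {N : ℕ} (n j : ℕ)
    (hj : j + n ≤ N) : Measurable (schemeExpectation a σ t₀ ((T - t₀) / N) f n j) := by
  induction n generalizing j with
  | zero => exact hf
  | succ n ih =>
    exact ((ih (j + 1) (by omega)).comp
      (measurable_balancedStep hc hT (by omega : j < N))).lintegral_prod_right'

/-- Moments after `n` steps are bounded crudely, since every step has norm at most one. -/
theorem schemeExpectation_le_of_steps {h : ℝ} (hh : 0 ≤ h) {p : ℝ} (hp : 0 ≤ p) (n j : ℕ)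
    (x : EuclideanSpace ℝ (Fin d)) :
    schemeExpectation a σ t₀ h (fun x => ENNReal.ofReal ((1 + ‖x‖ ^ 2) ^ p)) n j x
      ≤ ENNReal.ofReal ((1 + (‖x‖ + n) ^ 2) ^ p) := by
  induction n generalizing j x with
  | zero => simp [schemeExpectation]
  | succ n ih =>
    rw [schemeExpectation]
    calc _ ≤ ∫⁻ _ : Fin m → ℝ, ENNReal.ofReal ((1 + (‖x‖ + (n + 1 : ℕ)) ^ 2) ^ p)
          ∂stdGaussianPi m := by
          refine lintegral_mono fun z => (ih _ _).trans (ENNReal.ofReal_le_ofReal ?_)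
          have h1 := norm_balancedIncr_le_one hh (a (t₀ + j * h) x)
            (fun r => σ r (t₀ + j * h) x) z
          have h2 := norm_add_le x (balancedIncr h (a (t₀ + j * h) x)
            (fun r => σ r (t₀ + j * h) x) z)
          rw [balancedStep_eq_add_balancedIncr]
          refine Real.rpow_le_rpow (by positivity) ?_ hp
          push_cast
          gcongr 1 + ?_ ^ 2
          linarith
      _ = _ := by simp

/-- Where the coefficients are large relative to the step size, the crude bound is already of the
order of `(1 + ‖x‖ ^ 2) ^ (3 * p * ϰ)`. -/
theorem one_add_sq_rpow_le_of_large {N n q : ℕ} {X p : ℝ} (hX : 0 ≤ X) (hT : t₀ < T)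
    (hN : 1 ≤ N) (hn : n ≤ N) (hp : 0 ≤ p) (hϰ : 1 ≤ ϰ) (hq : 3 * p * ϰ ≤ q)
    (hlarge : 1 < (T - t₀) / N * (1 + X ^ 2) ^ ((3 * ϰ - 1) / 2)) :
    (1 + (X + n) ^ 2) ^ p ≤ (4 * (T - t₀) ^ 2) ^ p * (1 + X ^ 2) ^ q := by
  have hN1 : (1 : ℝ) ≤ N := by exact_mod_cast hN
  have hnN : (n : ℝ) ≤ N := by exact_mod_cast hn
  have hV1 : 1 ≤ 1 + X ^ 2 := by linarith [sq_nonneg X]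
  have hV0 : 0 < 1 + X ^ 2 := by linarith
  have h1 : (N : ℝ) ≤ (T - t₀) * (1 + X ^ 2) ^ ((3 * ϰ - 1) / 2) := by
    rw [div_mul_eq_mul_div, lt_div_iff₀ (by linarith)] at hlarge
    linarith
  have h2 : 1 + (X + n) ^ 2 ≤ 4 * (1 + X ^ 2) * (N : ℝ) ^ 2 := by
    have h3 : (X + n) ^ 2 ≤ (X + N) ^ 2 := by gcongr
    have h4 : (1 : ℝ) ≤ (N : ℝ) ^ 2 := by nlinarith
    nlinarith [sq_nonneg (X - N), mul_nonneg (sub_nonneg.2 hV1) (sub_nonneg.2 h4)]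
  have h3 : 1 + (X + n) ^ 2 ≤ 4 * (T - t₀) ^ 2 * (1 + X ^ 2) ^ (3 * ϰ) := by
    calc _ ≤ 4 * (1 + X ^ 2) * (N : ℝ) ^ 2 := h2
      _ ≤ 4 * (1 + X ^ 2) * ((T - t₀) * (1 + X ^ 2) ^ ((3 * ϰ - 1) / 2)) ^ 2 := by gcongr
      _ = 4 * (T - t₀) ^ 2 * ((1 + X ^ 2) * ((1 + X ^ 2) ^ ((3 * ϰ - 1) / 2)) ^ 2) := by ring
      _ = _ := by
        rw [← Real.rpow_two ((1 + X ^ 2) ^ ((3 * ϰ - 1) / 2)), ← Real.rpow_mul hV0.le,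
          ← Real.rpow_one_add' hV0.le (by linarith)]
        ring_nf
  calc _ ≤ (4 * (T - t₀) ^ 2 * (1 + X ^ 2) ^ (3 * ϰ)) ^ p :=
        Real.rpow_le_rpow (by positivity) h3 hp
    _ = (4 * (T - t₀) ^ 2) ^ p * (1 + X ^ 2) ^ (3 * ϰ * p) := by
        rw [Real.mul_rpow (by positivity) (by positivity), ← Real.rpow_mul hV0.le]
    _ ≤ _ := by
        rw [← Real.rpow_natCast _ q]
        refine mul_le_mul_of_nonneg_left ?_ (by positivity)
        exact Real.rpow_le_rpow_of_exponent_le hV1 (by linarith)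

/-- The factor `81 / 64 = (9 / 8) ^ 2` collects two losses: splitting the squared increment into
drift and noise, and passing from `σ r t x - σ r t 0` to `σ r t x`. -/
theorem exists_schemeExpectation_le (hT : t₀ < T)
    (hc : OneSidedLipschitzCoeffs a σ t₀ T p₀ ϰ) (hb : BoundedAtOrigin a σ t₀ T)
    {p : ℝ} (hp : 0 ≤ p) {q : ℕ} (hq : 1 ≤ q) (hqp : 3 * p * ϰ ≤ q)
    (hqp₀ : 81 / 64 * (q - 1 / 2 : ℝ) ≤ p₀ - 1 / 2) :
    ∃ K : ℝ, 0 < K ∧ ∀ N n j : ℕ, 1 ≤ N → j + n ≤ N → ∀ x,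
      schemeExpectation a σ t₀ ((T - t₀) / N) (fun x => ENNReal.ofReal ((1 + ‖x‖ ^ 2) ^ p)) n j x
        ≤ ENNReal.ofReal (K * (1 + ‖x‖ ^ 2) ^ q) := by
  have hϰ := hc.one_le_ϰ
  have hq1 : (1 : ℝ) ≤ q := by exact_mod_cast hq
  obtain ⟨C₁, hC₁, hcoer⟩ := hc.exists_coercive hb (θ := 9 / 8 * (q - 1 / 2)) (by linarith)
    (by linarith)
  obtain ⟨C₂, hC₂, hsmall⟩ := hc.exists_small_step_bounds hb
  obtain ⟨K, hK, hstep⟩ := exists_lintegral_balancedIncr_le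
    (E := EuclideanSpace ℝ (Fin d)) q m hq (C := C₁ + C₂) (by positivity)
  -- The summand `1` serves the start of the induction, the other one the points with large
  -- coefficients.
  set B := 1 + (4 * (T - t₀) ^ 2) ^ p
  have hτ : 0 < T - t₀ := by linarith
  have hB1 : 1 ≤ B := by
    have : 0 ≤ (4 * (T - t₀) ^ 2) ^ p := by positivity
    linarith
  refine ⟨B * Real.exp (K * (T - t₀)), by positivity, fun N n j hN hj x => ?_⟩
  have hN0 : (0 : ℝ) < N := by exact_mod_cast hN
  have hNτ : N * ((T - t₀) / N) = T - t₀ := mul_div_cancel₀ _ hN0.ne'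
  have hh : 0 ≤ (T - t₀) / N := by positivity
  have hlarge := fun (n : ℕ) (x : EuclideanSpace ℝ (Fin d)) (hn : n ≤ N) =>
    one_add_sq_rpow_le_of_large (norm_nonneg x) hT hN hn hp hϰ hqp
  have key : ∀ n j : ℕ, j + n ≤ N → ∀ x, schemeExpectation a σ t₀ ((T - t₀) / N)
      (fun x => ENNReal.ofReal ((1 + ‖x‖ ^ 2) ^ p)) n j x
        ≤ ENNReal.ofReal (B * (1 + K * ((T - t₀) / N)) ^ n * (1 + ‖x‖ ^ 2) ^ q) := by
    intro n
    induction n with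
    | zero =>
      intro j _ x
      have hV1 : 1 ≤ 1 + ‖x‖ ^ 2 := by linarith [sq_nonneg ‖x‖]
      refine ENNReal.ofReal_le_ofReal ?_
      calc (1 + ‖x‖ ^ 2) ^ p ≤ (1 + ‖x‖ ^ 2) ^ q := by
            rw [← Real.rpow_natCast _ q]
            refine Real.rpow_le_rpow_of_exponent_le hV1 (le_trans ?_ hqp)
            nlinarith
        _ ≤ _ := le_mul_of_one_le_left (by positivity) (by simpa using hB1)
    | succ n ih =>
      intro j hj x
      set h := (T - t₀) / N
      -- The split concerns only the current point `x`; the induction hypothesis holds everywhere,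
      -- so the next point may lie on either side.
      by_cases hx : h * (1 + ‖x‖ ^ 2) ^ ((3 * ϰ - 1) / 2) ≤ 1
      · have ht : t₀ + j * h ∈ Set.Icc t₀ T := grid_mem_Icc hT.le (by omega)
        obtain ⟨b1, b2, b3, b4⟩ := hsmall _ ht x h hh hx
        have hmono : ∀ {c y : ℝ}, 0 ≤ y → c ≤ C₂ * (1 + ‖x‖ ^ 2) →
            c ≤ (y + C₂) * (1 + ‖x‖ ^ 2) := fun hy hc => hc.trans (by gcongr; linarith)
        have hone := hstep h x (a (t₀ + j * h) x) (fun r => σ r (t₀ + j * h) x) hh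
          ((hcoer _ ht x).trans (by gcongr; linarith)) (hmono hC₁ b1) (hmono hC₁ b2)
          (hmono hC₁ b3) (hmono hC₁ b4)
        have hBn : 0 ≤ B * (1 + K * h) ^ n := by positivity
        calc _ ≤ ∫⁻ z, ENNReal.ofReal (B * (1 + K * h) ^ n) *
              ENNReal.ofReal ((1 + ‖x + balancedIncr h (a (t₀ + j * h) x)
                (fun r => σ r (t₀ + j * h) x) z‖ ^ 2) ^ q) ∂stdGaussianPi m := by
              rw [schemeExpectation]
              refine lintegral_mono fun z => (ih (j + 1) (by omega) _).trans_eq ?_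
              rw [← ENNReal.ofReal_mul hBn, balancedStep_eq_add_balancedIncr]
          _ ≤ ENNReal.ofReal (B * (1 + K * h) ^ n) *
              ENNReal.ofReal ((1 + K * h) * (1 + ‖x‖ ^ 2) ^ q) := by
              rw [lintegral_const_mul' _ _ ENNReal.ofReal_ne_top]
              gcongr
          _ = _ := by
              rw [← ENNReal.ofReal_mul hBn]
              congr 1
              ring
      · refine (schemeExpectation_le_of_steps hh hp _ _ _).trans (ENNReal.ofReal_le_ofReal ?_)
        refine (hlarge (n + 1) x (by omega) (not_le.1 hx)).trans ?_
        have h1 : 1 ≤ (1 + K * h) ^ (n + 1) := one_le_pow₀ (by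
          have : 0 ≤ K * h := by positivity
          linarith)
        gcongr
        calc (4 * (T - t₀) ^ 2) ^ p ≤ B := by simp [B]
          _ ≤ _ := le_mul_of_one_le_right (by positivity) h1
  refine (key n j hj x).trans (ENNReal.ofReal_le_ofReal ?_)
  gcongr
  calc (1 + K * ((T - t₀) / N)) ^ n ≤ Real.exp (K * ((T - t₀) / N)) ^ n := by
        gcongr
        rw [add_comm]
        exact Real.add_one_le_exp _
    _ = Real.exp (n * (K * ((T - t₀) / N))) := by rw [← Real.exp_nat_mul]
    _ ≤ _ := by
        refine Real.exp_le_exp.2 ?_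
        have : (n : ℝ) ≤ N := by exact_mod_cast (by omega : n ≤ N)
        calc n * (K * ((T - t₀) / N)) ≤ N * (K * ((T - t₀) / N)) := by gcongr
          _ = K * (N * ((T - t₀) / N)) := by ring
          _ = _ := by rw [hNτ]

end Scheme

/-! ### From independence of the noise to the Markov property of the scheme. -/

theorem ProbabilityTheory.IndepFun.lintegral_comp_prodMk {Ω β γ : Type*} [MeasurableSpace Ω]
    [MeasurableSpace β] [MeasurableSpace γ] {P : Measure Ω} [IsProbabilityMeasure P]
    {X : Ω → β} {Y : Ω → γ} (hXY : IndepFun X Y P) (hX : Measurable X) (hY : Measurable Y)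
    {G : β × γ → ENNReal} (hG : Measurable G) :
    ∫⁻ ω, G (X ω, Y ω) ∂P = ∫⁻ ω, ∫⁻ y, G (X ω, y) ∂(P.map Y) ∂P := by
  have : IsProbabilityMeasure (P.map Y) := Measure.isProbabilityMeasure_map hY.aemeasurable
  rw [← lintegral_map hG (hX.prodMk hY),
    (indepFun_iff_map_prod_eq_prod_map_map hX.aemeasurable hY.aemeasurable).1 hXY,
    lintegral_prod _ hG.aemeasurable, lintegral_map hG.lintegral_prod_right' hX]

section Path

variable {d m N : ℕ} {a : ℝ → EuclideanSpace ℝ (Fin d) → EuclideanSpace ℝ (Fin d)}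
  {σ : Fin m → ℝ → EuclideanSpace ℝ (Fin d) → EuclideanSpace ℝ (Fin d)} {t₀ T p₀ ϰ : ℝ}
  {Ω : Type*} [MeasurableSpace Ω] {P : Measure Ω}
  {X₀ : Ω → EuclideanSpace ℝ (Fin d)} {ξ : Fin N → Fin m → Ω → ℝ}

theorem balancedPath_succ (h : ℝ) (x₀ : EuclideanSpace ℝ (Fin d)) (z : Fin N → Fin m → ℝ)
    (k : Fin N) : balancedPath a σ t₀ h x₀ z k.succ =
      balancedStep a σ h (t₀ + (k : ℕ) * h) (balancedPath a σ t₀ h x₀ z k.castSucc) (z k) :=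
  rfl

theorem measurable_balancedPath (hc : OneSidedLipschitzCoeffs a σ t₀ T p₀ ϰ) (hT : t₀ ≤ T)
    (k : Fin (N + 1)) :
    Measurable fun y : EuclideanSpace ℝ (Fin d) × (Fin N × Fin m → ℝ) =>
      balancedPath a σ t₀ ((T - t₀) / N) y.1 (fun j r => y.2 (j, r)) k := by
  induction k using Fin.induction with
  | zero => exact measurable_fst
  | succ k ih =>
    simp only [balancedPath_succ]
    exact (measurable_balancedStep hc hT k.2).comp (ih.prodMk (by fun_prop))

theorem measurable_balancedStep_comp {Ω' : Type*} {mΩ' : MeasurableSpace Ω'}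
    (hc : OneSidedLipschitzCoeffs a σ t₀ T p₀ ϰ) (hT : t₀ ≤ T) {j : ℕ} (hj : j < N)
    {Y : Ω' → EuclideanSpace ℝ (Fin d)} {Z : Fin m → Ω' → ℝ} (hY : Measurable Y)
    (hZ : ∀ r, Measurable (Z r)) :
    Measurable fun ω => balancedStep a σ ((T - t₀) / N) (t₀ + j * ((T - t₀) / N)) (Y ω)
      (fun r => Z r ω) :=
  (measurable_balancedStep hc hT hj).comp (hY.prodMk (measurable_pi_lambda _ hZ))

/-- The path up to the `k`-th grid point is determined by the noise of the earlier steps. -/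
theorem measurable_iSup_balancedPath (hc : OneSidedLipschitzCoeffs a σ t₀ T p₀ ϰ) (hT : t₀ ≤ T)
    {Ω' : Type*} (x : EuclideanSpace ℝ (Fin d)) (ξ : Fin N → Fin m → Ω' → ℝ)
    (k : Fin (N + 1)) :
    Measurable[⨆ i ∈ {i : Fin N × Fin m | i.1.castSucc < k},
      MeasurableSpace.comap (ξ i.1 i.2) inferInstance]
      fun ω => balancedPath a σ t₀ ((T - t₀) / N) x (fun j r => ξ j r ω) k := by
  induction k using Fin.induction with
  | zero => exact measurable_const
  | succ k ih =>
    simp only [balancedPath_succ]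
    refine measurable_balancedStep_comp hc hT k.2 ?_ fun r => ?_
    · refine ih.mono (iSup₂_mono' fun i hi => ⟨i, ?_, le_rfl⟩) le_rfl
      exact lt_trans hi (Fin.castSucc_lt_succ)
    · refine (comap_measurable (ξ k r)).mono ?_ le_rfl
      exact le_iSup₂_of_le (f := fun (i : Fin N × Fin m) (_ : i ∈
        {i : Fin N × Fin m | i.1.castSucc < k.succ}) =>
          MeasurableSpace.comap (ξ i.1 i.2) inferInstance) (k, r) Fin.castSucc_lt_succ le_rfl

theorem IsGaussianNoise.indepFun_balancedPath (hξ : IsGaussianNoise P X₀ ξ)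
    (hc : OneSidedLipschitzCoeffs a σ t₀ T p₀ ϰ) (hT : t₀ ≤ T)
    (x : EuclideanSpace ℝ (Fin d)) (k : Fin N) :
    IndepFun (fun ω => balancedPath a σ t₀ ((T - t₀) / N) x (fun j r => ξ j r ω) k.castSucc)
      (fun ω r => ξ k r ω) P := by
  have hdisj : Disjoint {i : Fin N × Fin m | i.1.castSucc < k.castSucc}
      {i : Fin N × Fin m | i.1 = k} := by
    rw [Set.disjoint_left]
    rintro ⟨j, r⟩ h1 h2
    simp only [Set.mem_ofPred_eq] at h1 h2
    exact absurd h1 (by simp [h2])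
  have hind := indep_iSup_of_disjoint (fun i => (hξ.measurable i.1 i.2).comap_le)
    ((iIndepFun_iff_iIndep ..).1 hξ.indep) hdisj
  refine indep_of_indep_of_le_left (indep_of_indep_of_le_right hind ?_)
    (measurable_iSup_balancedPath hc hT x ξ k.castSucc).comap_le
  refine Measurable.comap_le (@measurable_pi_lambda _ _ _ (_) _ _ fun r => ?_)
  refine (comap_measurable (ξ k r)).mono ?_ le_rfl
  exact le_iSup₂_of_le (f := fun (i : Fin N × Fin m) (_ : i ∈ {i : Fin N × Fin m | i.1 = k}) =>
    MeasurableSpace.comap (ξ i.1 i.2) inferInstance) (k, r) rfl le_rfl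

theorem IsGaussianNoise.map_eq_stdGaussianPi [IsProbabilityMeasure P]
    (hξ : IsGaussianNoise P X₀ ξ) (k : Fin N) :
    P.map (fun ω r => ξ k r ω) = stdGaussianPi m := by
  have h1 : iIndepFun (fun r => ξ k r) P :=
    hξ.indep.precomp (g := fun r => (k, r)) fun r r' h => (Prod.ext_iff.1 h).2
  rw [(iIndepFun_iff_map_fun_eq_pi_map fun r => (hξ.measurable k r).aemeasurable).1 h1]
  simp_rw [hξ.law]

/-- The Markov property for a deterministic start: the state at step `j` is independent of the noise
of that step, so this noise can be integrated out with the state frozen, which is one unfolding of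
`schemeExpectation`. -/
theorem IsGaussianNoise.lintegral_balancedPath [IsProbabilityMeasure P]
    (hξ : IsGaussianNoise P X₀ ξ)
    (hc : OneSidedLipschitzCoeffs a σ t₀ T p₀ ϰ) (hT : t₀ ≤ T)
    {f : EuclideanSpace ℝ (Fin d) → ENNReal} (hf : Measurable f)
    (x : EuclideanSpace ℝ (Fin d)) (n j : ℕ) (hj : j + n < N + 1) :
    ∫⁻ ω, f (balancedPath a σ t₀ ((T - t₀) / N) x (fun j r => ξ j r ω) ⟨j + n, hj⟩) ∂P =
      ∫⁻ ω, schemeExpectation a σ t₀ ((T - t₀) / N) f n j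
        (balancedPath a σ t₀ ((T - t₀) / N) x (fun j r => ξ j r ω) ⟨j, by omega⟩) ∂P := by
  induction n generalizing j with
  | zero => rfl
  | succ n ih =>
    have h1 := ih (j + 1) (by omega)
    simp only [show j + 1 + n = j + (n + 1) by omega] at h1
    rw [h1]
    set k : Fin N := ⟨j, by omega⟩
    have hYm : Measurable fun ω => balancedPath a σ t₀ ((T - t₀) / N) x (fun j r => ξ j r ω)
        k.castSucc :=
      (measurable_balancedPath hc hT k.castSucc).comp (measurable_const.prodMk
        (measurable_pi_lambda _ fun i : Fin N × Fin m => hξ.measurable i.1 i.2))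
    have hM : Measurable (schemeExpectation a σ t₀ ((T - t₀) / N) f n (j + 1)) :=
      measurable_schemeExpectation hc hT hf n (j + 1) (by omega)
    have h2 := (hξ.indepFun_balancedPath hc hT x k).lintegral_comp_prodMk hYm
      (measurable_pi_lambda _ fun r => hξ.measurable k r)
      (hM.comp (measurable_balancedStep hc hT k.2))
    rw [hξ.map_eq_stdGaussianPi] at h2
    exact h2

/-- Joint independence of `X₀` and the whole noise allows the initial value to be frozen, which
reduces to a deterministic start. -/
theorem IsGaussianNoise.lintegral_balancedScheme [IsProbabilityMeasure P]
    (hξ : IsGaussianNoise P X₀ ξ)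
    (hc : OneSidedLipschitzCoeffs a σ t₀ T p₀ ϰ) (hT : t₀ ≤ T) (hX₀ : Measurable X₀)
    {f : EuclideanSpace ℝ (Fin d) → ENNReal} (hf : Measurable f) (k : Fin (N + 1)) :
    ∫⁻ ω, f (balancedScheme a σ t₀ T X₀ ξ k ω) ∂P =
      ∫⁻ ω, schemeExpectation a σ t₀ ((T - t₀) / N) f k 0 (X₀ ω) ∂P := by
  have hξm : Measurable fun ω (i : Fin N × Fin m) => ξ i.1 i.2 ω :=
    measurable_pi_lambda _ fun i => hξ.measurable i.1 i.2
  have h1 := hξ.indep_init.lintegral_comp_prodMk hX₀ hξm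
    (hf.comp (measurable_balancedPath hc hT k))
  refine h1.trans (lintegral_congr fun ω => ?_)
  have h4 : Measurable fun z => (f ∘ fun y : EuclideanSpace ℝ (Fin d) × (Fin N × Fin m → ℝ) =>
      balancedPath a σ t₀ ((T - t₀) / N) y.1 (fun j r => y.2 (j, r)) k) (X₀ ω, z) :=
    (hf.comp (measurable_balancedPath hc hT k)).comp measurable_prodMk_left
  rw [lintegral_map h4 hξm]
  have h2 := hξ.lintegral_balancedPath hc hT hf (X₀ ω) k 0 (by omega)
  simp only [zero_add] at h2
  refine h2.trans ((lintegral_congr (g := fun _ =>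
    schemeExpectation a σ t₀ ((T - t₀) / N) f k 0 (X₀ ω)) fun _ => rfl).trans (by simp))

theorem IsGaussianNoise.measurable_balancedScheme (hξ : IsGaussianNoise P X₀ ξ)
    (hc : OneSidedLipschitzCoeffs a σ t₀ T p₀ ϰ) (hT : t₀ ≤ T) (hX₀ : Measurable X₀)
    (k : Fin (N + 1)) : Measurable (balancedScheme a σ t₀ T X₀ ξ k) :=
  (measurable_balancedPath hc hT k).comp
    (hX₀.prodMk (measurable_pi_lambda _ fun i : Fin N × Fin m => hξ.measurable i.1 i.2))

end Path

/-! ### The moment bound. -/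

theorem mainTheorem5 {d m : ℕ}
    (a : ℝ → EuclideanSpace ℝ (Fin d) → EuclideanSpace ℝ (Fin d))
    (σ : Fin m → ℝ → EuclideanSpace ℝ (Fin d) → EuclideanSpace ℝ (Fin d))
    (t₀ T p₀ ϰ : ℝ) (hT : t₀ < T)
    (hcoeff : OneSidedLipschitzCoeffs a σ t₀ T p₀ ϰ)
    (hbdd : BoundedAtOrigin a σ t₀ T)
    (p : ℝ) (hp1 : 1 ≤ p) (hp2 : p ≤ (p₀ - 1) / (4 * (3 * ϰ - 2)) - 1 / 2) :
    ∃ β : ℝ, 1 ≤ β ∧ ∃ K : ℝ, 0 < K ∧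
      ∀ (Ω : Type*) [MeasurableSpace Ω] (P : Measure Ω) [IsProbabilityMeasure P]
        (X₀ : Ω → EuclideanSpace ℝ (Fin d)), HasAllMoments P X₀ →
      ∀ (N : ℕ), 1 ≤ N → ∀ (ξ : Fin N → Fin m → Ω → ℝ), IsGaussianNoise P X₀ ξ →
      ∀ k : Fin (N + 1),
        Integrable (fun ω => ‖balancedScheme a σ t₀ T X₀ ξ k ω‖ ^ (2 * p)) P ∧
        ∫ ω, ‖balancedScheme a σ t₀ T X₀ ξ k ω‖ ^ (2 * p) ∂P
          ≤ K * (1 + ∫ ω, ‖X₀ ω‖ ^ (2 * p * β) ∂P) := by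
  have hϰ := hcoeff.one_le_ϰ
  have hp0 : 0 < p := by linarith
  have hpϰ : 1 ≤ p * ϰ := one_le_mul_of_one_le_of_one_le hp1 hϰ
  set q := ⌈3 * p * ϰ⌉₊
  have hqp : 3 * p * ϰ ≤ q := Nat.le_ceil _
  have hq1 : (1 : ℝ) ≤ q := by linarith
  have hq : 1 ≤ q := by exact_mod_cast hq1
  have hqlt : (q : ℝ) < 3 * p * ϰ + 1 := Nat.ceil_lt_add_one (by linarith)
  have hp₀ : 4 * (3 * ϰ - 2) * (p + 1 / 2) ≤ p₀ - 1 := by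
    have h1 : p + 1 / 2 ≤ (p₀ - 1) / (4 * (3 * ϰ - 2)) := by linarith
    rw [le_div_iff₀ (by linarith)] at h1
    linarith
  -- With `q < 3 * p * ϰ + 1` this reduces to an inequality in `p` and `ϰ`. At `ϰ = 1` its leading
  -- terms in `p` are `3 * 81 / 64` against `4`, so the factor `81 / 64` has to stay below `4 / 3`;
  -- the weights `9 / 8` ensure this.
  have hqp₀ : 81 / 64 * (q - 1 / 2 : ℝ) ≤ p₀ - 1 / 2 := by
    nlinarith [mul_nonneg (sub_nonneg.2 hp1) (sub_nonneg.2 hϰ)]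
  obtain ⟨K, hK, hmom⟩ := exists_schemeExpectation_le hT hcoeff hbdd hp0.le hq hqp hqp₀
  -- The factor `2 ^ (q - 1)` comes from convexity, `(1 + s) ^ q ≤ 2 ^ (q - 1) * (1 + s ^ q)` with
  -- `s = ‖X₀ ω‖ ^ 2`.
  refine ⟨q / p, ?_, K * 2 ^ (q - 1), by positivity, fun Ω _ P _ X₀ hX₀ N hN ξ hξ k => ?_⟩
  · rw [le_div_iff₀ hp0]
    nlinarith
  have hexp : 2 * p * (q / p) = 2 * q := by field_simp
  rw [hexp]
  have hX₀i : Integrable (fun ω => ‖X₀ ω‖ ^ (2 * q : ℝ)) P := hX₀.2 q hq1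
  have hmeas := hξ.measurable_balancedScheme hcoeff hT.le hX₀.1 k
  have hg : Integrable (fun ω => K * 2 ^ (q - 1) * (1 + ‖X₀ ω‖ ^ (2 * q : ℝ))) P :=
    ((integrable_const 1).add hX₀i).const_mul _
  have hlin : ∫⁻ ω, ENNReal.ofReal (‖balancedScheme a σ t₀ T X₀ ξ k ω‖ ^ (2 * p)) ∂P
      ≤ ENNReal.ofReal (K * 2 ^ (q - 1) * (1 + ∫ ω, ‖X₀ ω‖ ^ (2 * q : ℝ) ∂P)) := by
    calc _ ≤ ∫⁻ ω, ENNReal.ofReal ((1 + ‖balancedScheme a σ t₀ T X₀ ξ k ω‖ ^ 2) ^ p) ∂P := by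
          refine lintegral_mono fun ω => ENNReal.ofReal_le_ofReal ?_
          rw [Real.rpow_mul (norm_nonneg _), Real.rpow_two]
          exact Real.rpow_le_rpow (by positivity) (by linarith) hp0.le
      _ = ∫⁻ ω, schemeExpectation a σ t₀ ((T - t₀) / N)
            (fun x => ENNReal.ofReal ((1 + ‖x‖ ^ 2) ^ p)) k 0 (X₀ ω) ∂P :=
          hξ.lintegral_balancedScheme hcoeff hT.le hX₀.1
            (f := fun x => ENNReal.ofReal ((1 + ‖x‖ ^ 2) ^ p)) (by fun_prop) k
      _ ≤ ∫⁻ ω, ENNReal.ofReal (K * 2 ^ (q - 1) * (1 + ‖X₀ ω‖ ^ (2 * q : ℝ))) ∂P := by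
          refine lintegral_mono fun ω => (hmom N k 0 hN (by omega) (X₀ ω)).trans
            (ENNReal.ofReal_le_ofReal ?_)
          rw [mul_assoc, Real.rpow_mul (norm_nonneg _), Real.rpow_two, Real.rpow_natCast]
          gcongr
          simpa using add_pow_le (zero_le_one) (sq_nonneg ‖X₀ ω‖) q
      _ = _ := by
          rw [← ofReal_integral_eq_lintegral_ofReal hg
            (Filter.Eventually.of_forall fun ω => by positivity), integral_const_mul,
            integral_add (integrable_const 1) hX₀i]
          simp
  have hnn : 0 ≤ᵐ[P] fun ω => ‖balancedScheme a σ t₀ T X₀ ξ k ω‖ ^ (2 * p) :=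
    Filter.Eventually.of_forall fun ω => by positivity
  have hsm : AEStronglyMeasurable
      (fun ω => ‖balancedScheme a σ t₀ T X₀ ξ k ω‖ ^ (2 * p)) P :=
    (hmeas.norm.pow_const _).aestronglyMeasurable
  refine ⟨⟨hsm, ?_⟩, ?_⟩
  · rw [hasFiniteIntegral_iff_ofReal hnn]
    exact hlin.trans_lt ENNReal.ofReal_lt_top
  · rw [integral_eq_lintegral_of_nonneg_ae hnn hsm]
    have : 0 ≤ ∫ ω, ‖X₀ ω‖ ^ (2 * q : ℝ) ∂P := integral_nonneg fun ω => by positivity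
    exact ENNReal.toReal_le_of_le_ofReal (by positivity) hlin
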